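/- Let $n\ge 3$. A generalized $n$-gon is a bipartite graph of diameter $n$ and girth $2n$ in which every vertex has valency at least $3$. In a subgraph (taken as an induced subgraph on a set of vertices), a loose end is a vertex of valency at most $1$, and a clean arc is given by a path $(x_0,\dots,x_{n-1})$ whose inner vertices $x_1,\dots,x_{n-2}$ have valency $2$ in the subgraph; its endpoints are $x_0,x_{n-1}$. A generalized $n$-gon is open if every nonempty finite subgraph contains a loose end or a clean arc. Let $T_n$ be the theory of open generalized $n$-gons in the language of graphs expanded by two predicates for the bipartition. For a set $A$ of vertices of an open generalized $n$-gon $M$, a set $B$ disjoint from $A$ is closed over $A$ if, in the subgraph $A\cup B$, the set $B$ contains neither a loose end nor (the inner vertices of) a clean arc with endpoints in $A\cup B$; write $A\le_o M$ if no nonempty finite set is closed over $A$. Then algebraic closure and definable closure differ in $T_n$: there are an open generalized $n$-gon $M\models T_n$ and a finite $A\subseteq M$ with $\mathrm{acl}(A)\ne\mathrm{dcl}(A)$. More explicitly, $M$ can be chosen such that moreover: (odd $n$) There are an ordered $(2n+2)$-cycle $A=(x_0,\dots,x_{2n+2}=x_0)\le_o M$ and, for $i=0,\dots,n$, paths $\gamma_i$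 of length $n-1$ from $x_i$ to $x_{i+n+1}$ that give clean arcs in $A\cup\bigcup_i\gamma_i$, such that, $m_i$ being the midpoint of $\gamma_i$, every vertex of $A$ lies in $\mathrm{acl}(m_0,\dots,m_n)$ and no vertex of $A$ lies in $\mathrm{dcl}(m_0,\dots,m_n)$. (even $n$) There are an ordered $2n$-cycle $A=(x_0,\dots,x_{2n}=x_0)$ and, for $i=0,\dots,n-1$, a neighbour $y_i\notin\{x_{i-1},x_{i+1}\}$ of $x_i$, with $D=A\cup\{y_0,\dots,y_{n-1}\}\le_o M$, and paths $\gamma_i$ of length $n-1$ from $y_i$ to $x_{i+n}$ that give clean arcs in $D\cup\bigcup_i\gamma_i$, such that, $z_i$ being the neighbour of $x_{i+n}$ on $\gamma_i$ and $m_i$ the middle vertex of the part of $\gamma_i$ from $y_i$ to $z_i$ (of length $n-2$), every vertex of $A$ lies in $\mathrm{acl}(m_0,\dots,m_{n-1})$ and no vertex of $A$ lies in $\mathrm{dcl}(m_0,\dots,m_{n-1})$. -/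

import Mathlib

open FirstOrder

/-! ### Generalized polygons and openness -/

namespace OpenPolygon

variable {V : Type*}

/-- The valency of the vertex `v` in the (induced) subgraph of `G` with vertex set `C`. -/
noncomputable def valencyIn (G : SimpleGraph V) (C : Set V) (v : V) : ℕ∞ :=
  (G.neighborSet v ∩ C).encard

/-- The bipartite graph `G` with classes `P` (points) and `Pᶜ` (lines) is a generalized `n`-gon:
it has diameter `n` and girth `2n`, and it is thick. -/
structure IsGeneralizedPolygon (n : ℕ) (G : SimpleGraph V) (P : Set V) : Prop where
  bipartite : G.IsBipartiteWith P Pᶜ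
  diam : G.ediam = n
  girth : G.egirth = 2 * n
  thick : ∀ v, 3 ≤ (G.neighborSet v).encard

/-- A loose end of the subgraph `C`: a vertex of `C` of valency at most one in `C`. -/
def IsLooseEnd (G : SimpleGraph V) (C : Set V) (v : V) : Prop :=
  v ∈ C ∧ valencyIn G C v ≤ 1

/-- The path `p = (x₀, …, x_{n-1})` in the subgraph `C` gives a clean arc `(x₁, …, x_{n-2})`
of `C` with endpoints `x₀`, `x_{n-1}`: the inner vertices all have valency two in `C`. -/
def IsCleanArc (n : ℕ) (G : SimpleGraph V) (C : Set V) {x y : V} (p : G.Walk x y) : Prop :=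
  p.IsPath ∧ p.length + 1 = n ∧ (∀ v ∈ p.support, v ∈ C) ∧
    ∀ j, 1 ≤ j → j + 2 ≤ n → valencyIn G C (p.getVert j) = 2

/-- `G` is open: every nonempty finite subgraph contains a loose end or a clean arc. -/
def IsOpenGraph (n : ℕ) (G : SimpleGraph V) : Prop :=
  ∀ C : Set V, C.Finite → C.Nonempty →
    (∃ v, IsLooseEnd G C v) ∨ ∃ (x y : V) (p : G.Walk x y), IsCleanArc n G C p

/-- Open generalized `n`-gons. -/
structure IsOpenPolygon (n : ℕ) (G : SimpleGraph V) (P : Set V) : Prop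
    extends IsGeneralizedPolygon n G P where
  isOpen : IsOpenGraph n G

/-- `B` is closed over `A`: `B` is disjoint from `A`, and in the graph `A ∪ B` there is neither a
loose end lying in `B` nor a clean arc (with endpoints in `A ∪ B`) lying in `B`. -/
def IsClosedOver (n : ℕ) (G : SimpleGraph V) (A B : Set V) : Prop :=
  Disjoint A B ∧ (∀ v ∈ B, ¬ IsLooseEnd G (A ∪ B) v) ∧
    ∀ (x y : V) (p : G.Walk x y), IsCleanArc n G (A ∪ B) p →
      ¬ ∀ j, 1 ≤ j → j + 2 ≤ n → p.getVert j ∈ B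

/-- `A ≤ₒ G`: no nonempty finite set of vertices is closed over `A`. -/
def IsStrong (n : ℕ) (G : SimpleGraph V) (A : Set V) : Prop :=
  ∀ B : Set V, B.Finite → B.Nonempty → ¬ IsClosedOver n G A B

/-! ### The two configurations -/

/-- `x` is an ordered cycle of length `N` (used only for `N ≥ 3`). -/
def IsOrderedCycle {N : ℕ} (G : SimpleGraph V) (x : ZMod N → V) : Prop :=
  Function.Injective x ∧ ∀ i, G.Adj (x i) (x (i + 1))

/-- The configuration for odd `n`: an ordered `(2n+2)`-cycle `A = (x₀, …, x_{2n+2} = x₀)` with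
`A ≤ₒ G`, together with paths `γᵢ` of length `n - 1` from `xᵢ` to `x_{i+n+1}` (`0 ≤ i ≤ n`) which
give clean arcs in `C = A ∪ ⋃ᵢ γᵢ`; the vertex `mᵢ` is the midpoint of `γᵢ`. -/
def IsOddConfiguration (n : ℕ) (G : SimpleGraph V) (x : ZMod (2 * n + 2) → V)
    (m : Fin (n + 1) → V) : Prop :=
  IsOrderedCycle G x ∧ IsStrong n G (Set.range x) ∧
    ∃ γ : ∀ i : Fin (n + 1),
        G.Walk (x ((i : ℕ) : ZMod (2 * n + 2))) (x ((i + n + 1 : ℕ) : ZMod (2 * n + 2))),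
      ∀ i, IsCleanArc n G (Set.range x ∪ ⋃ k, {v | v ∈ (γ k).support}) (γ i) ∧
        m i = (γ i).getVert ((n - 1) / 2)

/-- The configuration for even `n`: an ordered `2n`-cycle `A = (x₀, …, x_{2n} = x₀)` and, for `n`
consecutive indices `i`, a neighbour `yᵢ` of `xᵢ` different from `x_{i-1}` and `x_{i+1}`, such
that `D = A ∪ {yᵢ}ᵢ ≤ₒ G`, together with paths `γᵢ` of length `n - 1` from `yᵢ` to `x_{i+n}` which
give clean arcs in `C = D ∪ ⋃ᵢ γᵢ`. If `zᵢ` is the neighbour of `x_{i+n}` on `γᵢ`, then `mᵢ` is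
the midpoint of the part of `γᵢ` from `yᵢ` to `zᵢ`, a path of even length `n - 2`. -/
def IsEvenConfiguration (n : ℕ) (G : SimpleGraph V) (x : ZMod (2 * n) → V)
    (y m : Fin n → V) : Prop :=
  IsOrderedCycle G x ∧
    (∀ i : Fin n, G.Adj (x ((i : ℕ) : ZMod (2 * n))) (y i) ∧
      y i ≠ x (((i : ℕ) : ZMod (2 * n)) - 1) ∧ y i ≠ x (((i : ℕ) : ZMod (2 * n)) + 1)) ∧
    IsStrong n G (Set.range x ∪ Set.range y) ∧
    ∃ γ : ∀ i : Fin n, G.Walk (y i) (x ((i + n : ℕ) : ZMod (2 * n))),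
      ∀ i, IsCleanArc n G
          (Set.range x ∪ Set.range y ∪ ⋃ k, {v | v ∈ (γ k).support}) (γ i) ∧
        m i = (γ i).getVert ((n - 2) / 2)

/-! ### The first-order theory -/

/-- Relation symbols: adjacency and the two predicates of the bipartition. -/
inductive BipRel : ℕ → Type
  | adj : BipRel 2
  | point : BipRel 1
  | line : BipRel 1

/-- The language of graphs expanded by predicates for the bipartition. -/
def bipLanguage : Language := ⟨fun _ => Empty, BipRel⟩

/-- The first-order structure given by a graph with distinguished bipartition `P`, `Pᶜ`. -/
@[reducible]
def bipStructure (G : SimpleGraph V) (P : Set V) : bipLanguage.Structure V where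
  funMap f := nomatch f
  RelMap
    | .adj => fun v => G.Adj (v 0) (v 1)
    | .point => fun v => v 0 ∈ P
    | .line => fun v => v 0 ∉ P

/-- `T_n`: the theory of open generalized `n`-gons, i.e. all sentences true in all of them. -/
def openPolygonTheory (n : ℕ) : bipLanguage.Theory :=
  {φ | ∀ (W : Type) (G : SimpleGraph W) (P : Set W), IsOpenPolygon n G P →
    letI := bipStructure G P
    W ⊨ φ}

end OpenPolygon

/-! ### Algebraic and definable closure -/

/-- `a ∈ acl A`: `a` lies in a finite set definable with parameters from `A`. -/
def FirstOrder.Language.acl (L : Language) {M : Type*} [L.Structure M] (A : Set M) : Set M :=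
  {a | ∃ s : Set M, A.Definable₁ L s ∧ s.Finite ∧ a ∈ s}

/-- `a ∈ dcl A`: the singleton `{a}` is definable with parameters from `A`. -/
def FirstOrder.Language.dcl (L : Language) {M : Type*} [L.Structure M] (A : Set M) : Set M :=
  {a | A.Definable₁ L {a}}

/-! ### Vertices and stages of the construction -/

namespace OpenPolygon

/-! The model is built from a cycle of length `2k` by joining each pair of antipodal vertices by an
arc of length `2h` with `2h + k = 2n`. This finite graph is stage 1. It is then completed freely: at
each later stage, any two vertices of suitable parity that are not joined by a walk of length at
most `n` receive a new arc of length `n - 1`, and isolated vertices of both colours are thrown in to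
ensure thickness. For odd `n` one takes `k = n + 1` and `2h = n - 1`, for even `n` one takes `k = n`
and `2h = n`. The parameters `mᵢ` are the midpoints of the antipodal arcs.

The union is a generalized `n`-gon: no stage contains a closed walk without backtracking of length
less than `2n` (`girth_stage`), and distances at most `n` are forced by the added arcs
(`exists_walk_le`). It is open because a finite set has a vertex of latest stage. This vertex is
isolated or lies on an arc whose inner vertices have no further neighbours in the set, which yields
a loose end or a clean arc (`IsArc.not_isClosedOver`, `isStrong_of_tagLE`, `isStrong_empty`).

Algebraicity: consider an embedding of stage 1 that fixes the midpoints. The part of its image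
outside stage 1 has no loose ends, since all valencies in stage 1 are at least two. It also contains
no clean arc, since cycle vertices have valency at least three, and fixed midpoints cut the arcs
into halves with too few inner vertices. As stage 1 is strong in the polygon, that part is empty
(`IsEmb.range_subset`). So the definable set of images of a given vertex is finite (`mem_acl`).

Non-definability: the antipodal map of the cycle reverses every arc of stage 1 and extends through
the free completion to an automorphism (`antipodeAut`). It fixes all midpoints and moves every
vertex of the cycle (`cyc_notMem_dcl`). -/

/-- Numerical data: a cycle of length `N = 2k`, whose antipodal vertices are to be joined by arcs of
length `2h`. -/
structure CycleParams where
  /-- The diameter of the polygon. -/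
  n : ℕ
  /-- The length of the cycle. -/
  N : ℕ
  /-- Half the length of the cycle. -/
  k : ℕ
  /-- Half the length of the arcs between antipodal vertices. -/
  h : ℕ
  three_le : 3 ≤ n
  N_eq : N = 2 * k
  -- Evenness of `k` makes the antipodal map preserve colours. By `sum_eq`, an arc closes up with
  -- half of the cycle to a `2n`-cycle. By `n_le`, an arc is long enough to contain a clean arc, and
  -- by `le_n` half an arc is too short for that.
  even_k : Even k
  sum_eq : 2 * h + k = 2 * n
  n_le : n ≤ 2 * h + 1
  le_n : 2 * h ≤ n

/-- Names for vertices: `base j` are the vertices of the cycle, `arc i a b t` is the vertex in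
distance `t` from `a` on an arc from `a` to `b` that is added at stage `i`, and `iso i c` is a new
vertex of colour `c` added at stage `i`. -/
inductive Vtx (N : ℕ) : Type
  | base (j : ZMod N) : Vtx N
  | arc (i : ℕ) (a b : Vtx N) (t : ℕ) : Vtx N
  | iso (i : ℕ) (c : ZMod 2) : Vtx N

namespace Vtx

/-- The colour of a vertex, which gives the bipartition. -/
def color {N : ℕ} : Vtx N → ZMod 2
  | base j => j.cast
  | arc _ a _ t => a.color + t
  | iso _ c => c

/-- The first stage that contains a vertex. -/
def tag {N : ℕ} : Vtx N → ℕ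
  | base _ => 0
  | arc i _ _ _ => i + 1
  | iso i _ => i + 1

end Vtx

variable (p : CycleParams)

lemma CycleParams.n_le_k : p.n ≤ p.k := by have := p.sum_eq; have := p.le_n; omega

lemma CycleParams.one_le_h : 1 ≤ p.h := by have := p.n_le; have := p.three_le; omega

instance : NeZero p.N := ⟨by have := p.n_le_k; have := p.three_le; have := p.N_eq; omega⟩

lemma CycleParams.two_dvd : 2 ∣ p.N := ⟨p.k, p.N_eq⟩

lemma CycleParams.k_add_k : (p.k : ZMod p.N) + p.k = 0 := by
  have h : ((p.N : ℕ) : ZMod p.N) = 0 := ZMod.natCast_self _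
  rw [← Nat.cast_add, ← two_mul, ← p.N_eq, h]

lemma CycleParams.natCast_eq_iff {a b : ℕ} (ha : a < p.N) (hb : b < p.N) :
    (a : ZMod p.N) = b ↔ a = b := by
  rw [ZMod.natCast_eq_natCast_iff', Nat.mod_eq_of_lt ha, Nat.mod_eq_of_lt hb]

lemma CycleParams.k_ne_zero : (p.k : ZMod p.N) ≠ 0 := by
  have := p.n_le_k; have := p.three_le; have := p.N_eq
  intro h
  have := (p.natCast_eq_iff (a := p.k) (b := 0) (by omega) (by omega)).1 (by simpa using h)
  omega

/-- The length of the arcs added at stage `i`. -/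
def len (i : ℕ) : ℕ := if i = 0 then 2 * p.h else p.n - 1

lemma two_le_len (i : ℕ) : 2 ≤ len p i := by
  have := p.one_le_h; have := p.three_le
  unfold len; split_ifs <;> omega

lemma n_le_len (i : ℕ) : p.n ≤ len p i + 1 := by
  have := p.n_le
  unfold len; split_ifs <;> omega

open Classical in
/-- The vertex in distance `t` from `a` on the arc of stage `i` between `a` and `b`. -/
noncomputable def mk (i : ℕ) (a b : Vtx p.N) (t : ℕ) : Vtx p.N :=
  -- Orienting each pair by a fixed well-ordering makes the arc from `a` to `b` and the arc from `b`
  -- to `a` consist of the same vertices, in opposite order.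
  if WellOrderingRel a b then .arc i a b t else .arc i b a (len p i - t)

/-- The vertices of the arc of stage `i` from `a` to `b`, including its endpoints. -/
noncomputable def pt (i : ℕ) (a b : Vtx p.N) (t : ℕ) : Vtx p.N :=
  if t = 0 then a else if t < len p i then mk p i a b t else b

variable {p}

lemma wo_asymm {a b : Vtx p.N} (h : WellOrderingRel a b) : ¬ WellOrderingRel b a :=
  fun h' => asymm_of WellOrderingRel h h'

lemma wo_total {a b : Vtx p.N} (hab : a ≠ b) (h : ¬ WellOrderingRel a b) : WellOrderingRel b a := by
  rcases trichotomous_of WellOrderingRel a b with h1 | h1 | h1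
  · exact absurd h1 h
  · exact absurd h1 hab
  · exact h1

lemma mk_symm {i : ℕ} {a b : Vtx p.N} {t : ℕ} (hab : a ≠ b) (ht : t ≤ len p i) :
    mk p i a b t = mk p i b a (len p i - t) := by
  unfold mk
  by_cases h : WellOrderingRel a b
  · rw [if_pos h, if_neg (wo_asymm h)]
    congr 1; omega
  · rw [if_neg h, if_pos (wo_total hab h)]

lemma mk_inj {i i' : ℕ} {a b a' b' : Vtx p.N} {t t' : ℕ}
    (ht : t < len p i) (ht' : t' < len p i')
    (h : mk p i a b t = mk p i' a' b' t') :
    i = i' ∧ ((a = a' ∧ b = b' ∧ t = t') ∨ (a = b' ∧ b = a' ∧ t = len p i - t')) := by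
  unfold mk at h
  split_ifs at h with h1 h2 h2 <;> injection h with e1 e2 e3 e4 <;> subst e1 <;>
    refine ⟨rfl, ?_⟩
  · exact Or.inl ⟨e2, e3, e4⟩
  · exact Or.inr ⟨e2, e3, e4⟩
  · exact Or.inr ⟨e3, e2, by omega⟩
  · exact Or.inl ⟨e3, e2, by omega⟩

@[simp] lemma tag_mk {i : ℕ} {a b : Vtx p.N} {t : ℕ} : (mk p i a b t).tag = i + 1 := by
  unfold mk; split_ifs <;> rfl

@[simp] lemma pt_zero {i : ℕ} {a b : Vtx p.N} : pt p i a b 0 = a := by simp [pt]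

lemma pt_of_len_le {i : ℕ} {a b : Vtx p.N} {t : ℕ} (h : len p i ≤ t) : pt p i a b t = b := by
  have := two_le_len p i
  rw [pt, if_neg (by omega), if_neg (by omega)]

lemma pt_inner {i : ℕ} {a b : Vtx p.N} {t : ℕ} (h0 : 0 < t) (h1 : t < len p i) :
    pt p i a b t = mk p i a b t := by
  rw [pt, if_neg (by omega), if_pos h1]

lemma pt_symm {i : ℕ} {a b : Vtx p.N} {t : ℕ} (hab : a ≠ b) (ht : t ≤ len p i) :
    pt p i a b t = pt p i b a (len p i - t) := by
  have := two_le_len p i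
  rcases Nat.eq_zero_or_pos t with rfl | h0
  · rw [pt_zero, pt_of_len_le (by omega)]
  rcases ht.lt_or_eq with h1 | rfl
  · rw [pt_inner h0 h1, pt_inner (by omega) (by omega), mk_symm hab ht]
  · rw [pt_of_len_le le_rfl]; simp

lemma color_pt {i : ℕ} {a b : Vtx p.N} {t : ℕ} (hc : b.color = a.color + (len p i : ℕ))
    (ht : t ≤ len p i) : (pt p i a b t).color = a.color + t := by
  rcases Nat.eq_zero_or_pos t with rfl | h0
  · simp
  rcases ht.lt_or_eq with h1 | rfl
  · rw [pt_inner h0 h1, mk]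
    split_ifs
    · rfl
    · change b.color + _ = _
      rw [hc, Nat.cast_sub ht]
      have : ((len p i : ℕ) : ZMod 2) + (len p i : ℕ) = 0 := CharTwo.add_self_eq_zero _
      have h2 : -((t : ℕ) : ZMod 2) = t := CharTwo.neg_eq _
      linear_combination this + h2
  · rw [pt_of_len_le le_rfl, hc]

/-! ### The stages -/

variable (p) in
/-- The pairs of vertices that are joined by an arc at stage `i`. -/
def JoinsIn (i : ℕ) (V : Set (Vtx p.N)) (G : SimpleGraph (Vtx p.N)) (a b : Vtx p.N) : Prop :=
  if i = 0 then ∃ j : ZMod p.N, a = .base j ∧ b = .base (j + p.k)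
  -- Quantifying over walks instead of comparing a distance also admits pairs in different
  -- components.
  else a ∈ V ∧ b ∈ V ∧ b.color = a.color + (len p i : ℕ) ∧ ∀ w : G.Walk a b, p.n < w.length

variable (p) in
/-- The vertex sets and the graphs of the stages. -/
noncomputable def stage : ℕ → Set (Vtx p.N) × SimpleGraph (Vtx p.N)
  | 0 => (Set.range .base,
      SimpleGraph.fromRel fun u v => ∃ j : ZMod p.N, u = .base j ∧ v = .base (j + 1))
  | i + 1 =>
    ((stage i).1 ∪
        {v | ∃ a b t, JoinsIn p i (stage i).1 (stage i).2 a b ∧ 0 < t ∧ t < len p i ∧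
          v = pt p i a b t} ∪
        -- With `1 ≤ i`, stage 1 consists of the cycle and its arcs only.
        {v | 1 ≤ i ∧ ∃ c, v = .iso i c},
      (stage i).2 ⊔ SimpleGraph.fromRel fun u v => ∃ a b t,
        JoinsIn p i (stage i).1 (stage i).2 a b ∧ t < len p i ∧
          u = pt p i a b t ∧ v = pt p i a b (t + 1))

variable (p) in
/-- The vertex set of stage `i`. -/
noncomputable abbrev SV (i : ℕ) : Set (Vtx p.N) := (stage p i).1

variable (p) in
/-- The graph of stage `i`. -/
noncomputable abbrev SG (i : ℕ) : SimpleGraph (Vtx p.N) := (stage p i).2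

variable (p) in
/-- The pairs of vertices that are joined by an arc at stage `i`. -/
def Joins (i : ℕ) (a b : Vtx p.N) : Prop := JoinsIn p i (SV p i) (SG p i) a b

lemma joins_zero {a b : Vtx p.N} :
    Joins p 0 a b ↔ ∃ j : ZMod p.N, a = .base j ∧ b = .base (j + p.k) := by
  simp [Joins, JoinsIn]

lemma joins_of_pos {i : ℕ} (hi : 0 < i) {a b : Vtx p.N} :
    Joins p i a b ↔ a ∈ SV p i ∧ b ∈ SV p i ∧ b.color = a.color + (len p i : ℕ) ∧
      ∀ w : (SG p i).Walk a b, p.n < w.length := by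
  simp [Joins, JoinsIn, hi.ne']

lemma mem_SV_zero {v : Vtx p.N} : v ∈ SV p 0 ↔ ∃ j, v = .base j := by
  change (∃ j, Vtx.base j = v) ↔ _
  simp only [eq_comm]

lemma mem_SV_succ {i : ℕ} {v : Vtx p.N} : v ∈ SV p (i + 1) ↔ v ∈ SV p i ∨
    (∃ a b t, Joins p i a b ∧ 0 < t ∧ t < len p i ∧ v = pt p i a b t) ∨
    (1 ≤ i ∧ ∃ c, v = .iso i c) := by
  simp only [SV, stage, Set.mem_union, or_assoc]; rfl

lemma SV_le_succ (i : ℕ) : SV p i ⊆ SV p (i + 1) := fun _ h => mem_SV_succ.2 (Or.inl h)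

lemma SV_mono : Monotone (SV p) := monotone_nat_of_le_succ SV_le_succ

lemma SG_mono : Monotone (SG p) := monotone_nat_of_le_succ fun i => by
  simp only [SG, stage]; exact le_sup_left

lemma joins_ne {i : ℕ} {a b : Vtx p.N} (h : Joins p i a b) : a ≠ b := by
  rcases Nat.eq_zero_or_pos i with rfl | hi
  · obtain ⟨j, rfl, rfl⟩ := joins_zero.1 h
    intro h; injection h with h
    exact p.k_ne_zero (by simpa using h)
  · rintro rfl
    have := ((joins_of_pos hi).1 h).2.2.2 .nil
    simp at this

lemma joins_symm {i : ℕ} {a b : Vtx p.N} (h : Joins p i a b) : Joins p i b a := by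
  rcases Nat.eq_zero_or_pos i with rfl | hi
  · obtain ⟨j, rfl, rfl⟩ := joins_zero.1 h
    exact joins_zero.2 ⟨j + p.k, rfl, by rw [add_assoc, p.k_add_k, add_zero]⟩
  · obtain ⟨h1, h2, h3, h4⟩ := (joins_of_pos hi).1 h
    refine (joins_of_pos hi).2 ⟨h2, h1, ?_, fun w => ?_⟩
    · rw [h3, add_assoc, CharTwo.add_self_eq_zero, add_zero]
    · simpa using h4 w.reverse

lemma joins_mem {i : ℕ} {a b : Vtx p.N} (h : Joins p i a b) : a ∈ SV p i := by
  rcases Nat.eq_zero_or_pos i with rfl | hi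
  · obtain ⟨j, rfl, rfl⟩ := joins_zero.1 h
    exact mem_SV_zero.2 ⟨j, rfl⟩
  · exact ((joins_of_pos hi).1 h).1

lemma color_base_add_one (j : ZMod p.N) :
    (Vtx.base (j + 1)).color = (Vtx.base j).color + 1 := by
  simp only [Vtx.color]
  rw [ZMod.cast_add p.two_dvd, ZMod.cast_one p.two_dvd]

lemma color_base_add_k (j : ZMod p.N) :
    (Vtx.base (j + (p.k : ZMod p.N))).color = (Vtx.base j).color := by
  simp only [Vtx.color]
  rw [ZMod.cast_add p.two_dvd, ZMod.cast_natCast p.two_dvd,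
    (ZMod.natCast_eq_zero_iff_even).2 p.even_k, add_zero]

lemma joins_color {i : ℕ} {a b : Vtx p.N} (h : Joins p i a b) :
    b.color = a.color + (len p i : ℕ) := by
  rcases Nat.eq_zero_or_pos i with rfl | hi
  · obtain ⟨j, rfl, rfl⟩ := joins_zero.1 h
    rw [color_base_add_k]
    have : ((len p 0 : ℕ) : ZMod 2) = 0 :=
      (ZMod.natCast_eq_zero_iff_even).2 ⟨p.h, by simp [len, two_mul]⟩
    rw [this, add_zero]
  · exact ((joins_of_pos hi).1 h).2.2.1

lemma tag_le_of_mem {i : ℕ} {v : Vtx p.N} (h : v ∈ SV p i) : v.tag ≤ i := by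
  induction i with
  | zero => obtain ⟨j, rfl⟩ := mem_SV_zero.1 h; exact le_rfl
  | succ i ih =>
    rcases mem_SV_succ.1 h with h | ⟨a, b, t, -, h0, h1, rfl⟩ | ⟨-, c, rfl⟩
    · exact (ih h).trans i.le_succ
    · rw [pt_inner h0 h1, tag_mk]
    · exact le_rfl

lemma mem_of_tag_le {i j : ℕ} {v : Vtx p.N} (h : v ∈ SV p j) (ht : v.tag ≤ i) : v ∈ SV p i := by
  rcases le_total j i with hij | hij
  · exact SV_mono hij h
  induction j, hij using Nat.le_induction with
  | base => exact h
  | succ j hij ih =>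
    rcases mem_SV_succ.1 h with h | ⟨a, b, t, -, h0, h1, rfl⟩ | ⟨-, c, rfl⟩
    · exact ih h
    · rw [pt_inner h0 h1, tag_mk] at ht; omega
    · change j + 1 ≤ i at ht; omega

lemma pt_mem {i : ℕ} {a b : Vtx p.N} (h : Joins p i a b) (t : ℕ) : pt p i a b t ∈ SV p (i + 1) := by
  rcases Nat.eq_zero_or_pos t with rfl | h0
  · rw [pt_zero]; exact SV_le_succ i (joins_mem h)
  rcases lt_or_ge t (len p i) with h1 | h1
  · exact mem_SV_succ.2 (Or.inr (Or.inl ⟨a, b, t, h, h0, h1, rfl⟩))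
  · rw [pt_of_len_le h1]; exact SV_le_succ i (joins_mem (joins_symm h))

lemma tag_pt_inner {i : ℕ} {a b : Vtx p.N} {t : ℕ} (h0 : 0 < t) (h1 : t < len p i) :
    (pt p i a b t).tag = i + 1 := by
  rw [pt_inner h0 h1, tag_mk]

lemma tag_joins {i : ℕ} {a b : Vtx p.N} (h : Joins p i a b) : a.tag ≤ i :=
  tag_le_of_mem (joins_mem h)

/-- On an arc, positions are determined by vertices, up to reversal of the arc. -/
lemma pt_inj {i : ℕ} {a b : Vtx p.N} (h : Joins p i a b) {s t : ℕ} (hs : s ≤ len p i)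
    (ht : t ≤ len p i) (e : pt p i a b s = pt p i a b t) : s = t := by
  have hl := two_le_len p i
  have hab := joins_ne h
  have ha := tag_joins h
  have hb := tag_joins (joins_symm h)
  have key : ∀ {s : ℕ}, s ≤ len p i → (s = 0 ∨ s = len p i ∨ (0 < s ∧ s < len p i)) := by
    intro s hs; omega
  rcases key hs with rfl | rfl | ⟨hs0, hs1⟩ <;> rcases key ht with rfl | rfl | ⟨ht0, ht1⟩
  · rfl
  · rw [pt_zero, pt_of_len_le le_rfl] at e; exact absurd e hab
  · have := congrArg Vtx.tag e
    rw [pt_zero, tag_pt_inner ht0 ht1] at this; omega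
  · rw [pt_zero, pt_of_len_le le_rfl] at e; exact absurd e.symm hab
  · rfl
  · have := congrArg Vtx.tag e
    rw [pt_of_len_le le_rfl, tag_pt_inner ht0 ht1] at this; omega
  · have := congrArg Vtx.tag e
    rw [pt_zero, tag_pt_inner hs0 hs1] at this; omega
  · have := congrArg Vtx.tag e
    rw [pt_of_len_le le_rfl, tag_pt_inner hs0 hs1] at this; omega
  · rw [pt_inner hs0 hs1, pt_inner ht0 ht1] at e
    rcases mk_inj hs1 ht1 e with ⟨-, ⟨-, -, e⟩ | ⟨e, -, -⟩⟩
    · exact e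
    · exact absurd e hab

lemma pt_inner_inj {i : ℕ} {a b a' b' : Vtx p.N} {s t : ℕ}
    (hs0 : 0 < s) (hs1 : s < len p i) (ht0 : 0 < t) (ht1 : t < len p i)
    (e : pt p i a b s = pt p i a' b' t) :
    (a = a' ∧ b = b' ∧ s = t) ∨ (a = b' ∧ b = a' ∧ s = len p i - t) := by
  rw [pt_inner hs0 hs1, pt_inner ht0 ht1] at e
  exact (mk_inj hs1 ht1 e).2

/-! ### Adjacency in the stages -/

lemma adj_zero {u v : Vtx p.N} : (SG p 0).Adj u v ↔
    ∃ j : ZMod p.N, u = .base j ∧ (v = .base (j + 1) ∨ v = .base (j - 1)) := by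
  simp only [SG, stage, SimpleGraph.fromRel_adj]
  constructor
  · rintro ⟨-, ⟨j, rfl, rfl⟩ | ⟨j, rfl, rfl⟩⟩
    · exact ⟨j, rfl, Or.inl rfl⟩
    · exact ⟨j + 1, rfl, Or.inr (by simp)⟩
  · have h1 : (1 : ZMod p.N) ≠ 0 := by
      have := p.n_le_k; have := p.three_le; have := p.N_eq
      intro h
      have := (p.natCast_eq_iff (a := 1) (b := 0) (by omega) (by omega)).1 (by simpa using h)
      omega
    rintro ⟨j, rfl, rfl | rfl⟩
    · refine ⟨fun h => ?_, Or.inl ⟨j, rfl, rfl⟩⟩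
      injection h with h; exact h1 (by simpa using h)
    · refine ⟨fun h => ?_, Or.inr ⟨j - 1, rfl, by simp⟩⟩
      injection h with h; exact h1 (by simpa using h.symm)

/-- No symmetric clause is needed, since an arc read backwards is again an arc of the same stage. -/
lemma adj_succ {i : ℕ} {u v : Vtx p.N} : (SG p (i + 1)).Adj u v ↔ (SG p i).Adj u v ∨
    ∃ a b t, Joins p i a b ∧ t < len p i ∧ u = pt p i a b t ∧ v = pt p i a b (t + 1) := by
  have : (SG p (i + 1)).Adj u v ↔ (SG p i).Adj u v ∨ (u ≠ v ∧
    ((∃ a b t, Joins p i a b ∧ t < len p i ∧ u = pt p i a b t ∧ v = pt p i a b (t + 1)) ∨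
    (∃ a b t, Joins p i a b ∧ t < len p i ∧ v = pt p i a b t ∧ u = pt p i a b (t + 1)))) := by
    simp only [SG, stage, SimpleGraph.sup_adj, SimpleGraph.fromRel_adj]; rfl
  rw [this]
  refine or_congr_right ⟨?_, ?_⟩
  · rintro ⟨-, h | ⟨a, b, t, h, ht, rfl, rfl⟩⟩
    · exact h
    · refine ⟨b, a, len p i - (t + 1), joins_symm h, by omega, pt_symm (joins_ne h) (by omega), ?_⟩
      rw [pt_symm (joins_ne h) (by omega)]
      congr 1; omega
  · rintro ⟨a, b, t, h, ht, rfl, rfl⟩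
    refine ⟨fun e => ?_, Or.inl ⟨a, b, t, h, ht, rfl, rfl⟩⟩
    have := pt_inj h (by omega) (by omega) e
    omega

lemma adj_mem {i : ℕ} {u v : Vtx p.N} (h : (SG p i).Adj u v) : u ∈ SV p i := by
  induction i with
  | zero => obtain ⟨j, rfl, -⟩ := adj_zero.1 h; exact mem_SV_zero.2 ⟨j, rfl⟩
  | succ i ih =>
    rcases adj_succ.1 h with h | ⟨a, b, t, hJ, ht, rfl, rfl⟩
    · exact SV_le_succ i (ih h)
    · exact pt_mem hJ t

lemma adj_color {i : ℕ} {u v : Vtx p.N} (h : (SG p i).Adj u v) : v.color = u.color + 1 := by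
  induction i with
  | zero =>
    obtain ⟨j, rfl, rfl | rfl⟩ := adj_zero.1 h
    · exact color_base_add_one j
    · have := color_base_add_one (j - 1)
      rw [sub_add_cancel] at this
      rw [this, add_assoc, CharTwo.add_self_eq_zero, add_zero]
  | succ i ih =>
    rcases adj_succ.1 h with h | ⟨a, b, t, hJ, ht, rfl, rfl⟩
    · exact ih h
    · rw [color_pt (joins_color hJ) ht.le, color_pt (joins_color hJ) ht]; push_cast; ring

lemma adj_pt {i : ℕ} {a b : Vtx p.N} (h : Joins p i a b) {t : ℕ} (ht : t < len p i) :
    (SG p (i + 1)).Adj (pt p i a b t) (pt p i a b (t + 1)) :=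
  adj_succ.2 (Or.inr ⟨a, b, t, h, ht, rfl, rfl⟩)

/-- The neighbours of an inner vertex of an arc, at the stage where the arc is added. -/
lemma adj_pt_inner {i : ℕ} {a b v : Vtx p.N} {t : ℕ} (h0 : 0 < t)
    (h1 : t < len p i) (ha : (SG p (i + 1)).Adj (pt p i a b t) v) :
    v = pt p i a b (t - 1) ∨ v = pt p i a b (t + 1) := by
  rcases adj_succ.1 ha with ha | ⟨a', b', s, h', hs, e, rfl⟩
  · have := tag_le_of_mem (adj_mem ha)
    rw [tag_pt_inner h0 h1] at this; omega
  · have hs0 : 0 < s := by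
      rcases Nat.eq_zero_or_pos s with rfl | h
      · have := congrArg Vtx.tag e
        rw [tag_pt_inner h0 h1, pt_zero] at this
        have := tag_joins h'; omega
      · exact h
    rcases pt_inner_inj h0 h1 hs0 hs e with ⟨rfl, rfl, rfl⟩ | ⟨rfl, rfl, rfl⟩
    · exact Or.inr rfl
    · refine Or.inl ?_
      rw [pt_symm (joins_ne h') (by omega)]; congr 1

/-- Later stages add no edges between the vertices of an earlier stage. -/
lemma adj_of_tag_le {i j : ℕ} {u v : Vtx p.N} (h : (SG p j).Adj u v) (hu : u.tag ≤ i)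
    (hv : v.tag ≤ i) : (SG p i).Adj u v := by
  rcases le_total j i with hij | hij
  · exact SG_mono hij h
  induction j, hij using Nat.le_induction with
  | base => exact h
  | succ j hij ih =>
    rcases adj_succ.1 h with h | ⟨a, b, t, h, ht, rfl, rfl⟩
    · exact ih h
    -- Arcs have length at least two, so every new edge contains an inner vertex, whose tag is `j +
    -- 1`.
    · exfalso
      have := two_le_len p j
      rcases Nat.eq_zero_or_pos t with rfl | h0
      · rw [tag_pt_inner (by omega) (by omega)] at hv; omega
      · rw [tag_pt_inner h0 ht] at hu; omega

lemma iso_not_adj {i : ℕ} {c : ZMod 2} {v : Vtx p.N} : ¬ (SG p (i + 1)).Adj (.iso i c) v := by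
  intro h
  rcases adj_succ.1 h with h | ⟨a, b, t, h, ht, e, -⟩
  · have := tag_le_of_mem (adj_mem h); change i + 1 ≤ i at this; omega
  · rcases Nat.eq_zero_or_pos t with rfl | h0
    · have := tag_joins h
      rw [pt_zero] at e
      rw [← e] at this; change i + 1 ≤ i at this; omega
    · rw [pt_inner h0 ht, mk] at e
      split_ifs at e

end OpenPolygon

namespace OpenPolygon

/-! ### Girth of the stages -/

/-- A periodic sequence of vertices without backtracking. -/
structure IsPeriodicWalk {V : Type*} (G : SimpleGraph V) (f : ℕ → V) (L : ℕ) : Prop where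
  pos : 0 < L
  adj : ∀ t, G.Adj (f t) (f (t + 1))
  ne : ∀ t, f t ≠ f (t + 2)
  per : ∀ t, f (t + L) = f t

lemma IsPeriodicWalk.shift {V : Type*} {G : SimpleGraph V} {f : ℕ → V} {L : ℕ}
    (h : IsPeriodicWalk G f L) (s : ℕ) : IsPeriodicWalk G (fun t => f (s + t)) L :=
  ⟨h.pos, fun t => h.adj (s + t), fun t => h.ne (s + t),
    fun t => by rw [← add_assoc]; exact h.per (s + t)⟩

lemma IsPeriodicWalk.per_mul {V : Type*} {G : SimpleGraph V} {f : ℕ → V} {L : ℕ}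
    (h : IsPeriodicWalk G f L) (m t : ℕ) : f (t + m * L) = f t := by
  induction m with
  | zero => simp
  | succ m ih => rw [Nat.succ_mul, ← add_assoc, h.per, ih]

variable {p : CycleParams}

lemma IsPeriodicWalk.color {i : ℕ} {f : ℕ → Vtx p.N} {L : ℕ} (h : IsPeriodicWalk (SG p i) f L)
    (t : ℕ) : (f t).color = (f 0).color + t := by
  induction t with
  | zero => simp
  | succ t ih => rw [adj_color (h.adj t), ih]; push_cast; ring

lemma IsPeriodicWalk.even {i : ℕ} {f : ℕ → Vtx p.N} {L : ℕ} (h : IsPeriodicWalk (SG p i) f L) :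
    Even L := by
  have h1 := h.color L
  have h2 := h.per 0
  rw [zero_add] at h2
  rw [h2, left_eq_add] at h1
  exact (ZMod.natCast_eq_zero_iff_even).1 h1

/-- Without backtracking, the walk runs around the cycle in a constant direction `e`, so `N` divides
`L`, and `N = 2k ≥ 2n`. -/
lemma girth_zero {f : ℕ → Vtx p.N} {L : ℕ} (h : IsPeriodicWalk (SG p 0) f L) : 2 * p.n ≤ L := by
  obtain ⟨j, hj, h1⟩ := adj_zero.1 (h.adj 0)
  have main : ∀ e : ZMod p.N, (e = 1 ∨ e = -1) → f 1 = .base (j + e) →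
      ∀ t : ℕ, f t = .base (j + t * e) ∧ f (t + 1) = .base (j + (t + 1) * e) := by
    intro e he hf t
    induction t with
    | zero => simpa using ⟨hj, hf⟩
    | succ t ih =>
      refine ⟨by push_cast; exact ih.2, ?_⟩
      obtain ⟨j', e1, e2⟩ := adj_zero.1 (h.adj (t + 1))
      rw [ih.2] at e1
      injection e1 with e1
      have h3 := h.ne t
      rw [ih.1] at h3
      push_cast
      rcases he with rfl | rfl <;> rcases e2 with e2 | e2
      · rw [e2, ← e1]; congr 1; ring
      · exact absurd (by rw [e2, ← e1]; congr 1; ring) h3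
      · exact absurd (by rw [e2, ← e1]; congr 1; ring) h3
      · rw [e2, ← e1]; congr 1; ring
  have hL : (L : ZMod p.N) = 0 := by
    have h2 := h.per 0
    rw [zero_add, hj] at h2
    rcases h1 with h1 | h1
    · rw [(main 1 (Or.inl rfl) h1 L).1] at h2
      injection h2 with h2
      simpa using h2
    · rw [(main (-1) (Or.inr rfl) (by rw [h1, sub_eq_add_neg]) L).1] at h2
      injection h2 with h2
      simpa using h2
  have := Nat.le_of_dvd h.pos ((ZMod.natCast_eq_zero_iff _ _).1 hL)
  have := p.N_eq; have := p.n_le_k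
  omega

/-- The integer `z` is the displacement of the walk lifted to the universal cover of the cycle. -/
lemma walk_zero {u v : Vtx p.N} (w : (SG p 0).Walk u v) : ∀ j j', u = .base j → v = .base j' →
    ∃ z : ℤ, |z| ≤ w.length ∧ j' = j + z := by
  induction w with
  | nil =>
    rintro j j' rfl h
    injection h with h
    exact ⟨0, by simp, by simp [h]⟩
  | cons hadj w ih =>
    rintro j j' rfl rfl
    obtain ⟨j1, e, e1⟩ := adj_zero.1 hadj
    injection e with e
    subst e
    rcases e1 with e1 | e1
    · obtain ⟨z, hz, e⟩ := ih _ _ e1 rfl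
      refine ⟨z + 1, ?_, ?_⟩
      · have := abs_add_le z 1
        rw [SimpleGraph.Walk.length_cons]; push_cast; simp at this; omega
      · rw [e]; push_cast; ring
    · obtain ⟨z, hz, e⟩ := ih _ _ e1 rfl
      refine ⟨z - 1, ?_, ?_⟩
      · have := abs_sub z 1
        rw [SimpleGraph.Walk.length_cons]; push_cast; simp at this; omega
      · rw [e]; push_cast; ring

/-- This is the inductive input for the girth: an arc and any walk that closes it up have total
length at least `2n`. At stage 0, a walk between antipodal vertices has length at least `k = 2n -
2h`. Later, the walk is longer than `n` and the arc has length `n - 1`. -/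
lemma Joins.far {i : ℕ} {a b : Vtx p.N} (h : Joins p i a b) (w : (SG p i).Walk a b) :
    2 * p.n ≤ len p i + w.length := by
  rcases Nat.eq_zero_or_pos i with rfl | hi
  · obtain ⟨j, e1, e2⟩ := joins_zero.1 h
    obtain ⟨z, hz, e⟩ := walk_zero w _ _ e1 e2
    by_contra hlt
    have h0 : ((p.k - z : ℤ) : ZMod p.N) = 0 := by
      push_cast
      rw [add_right_inj] at e
      rw [e, sub_self]
    rw [ZMod.intCast_zmod_eq_zero_iff_dvd] at h0
    have h1 : len p 0 = 2 * p.h := rfl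
    have := p.sum_eq
    have := p.N_eq
    rw [abs_le] at hz
    have := Int.le_of_dvd (by omega) h0
    omega
  · have := ((joins_of_pos hi).1 h).2.2.2 w
    have := n_le_len p i
    omega

lemma exists_walk {V : Type*} {G : SimpleGraph V} (f : ℕ → V) (m : ℕ)
    (h : ∀ t < m, G.Adj (f t) (f (t + 1))) :
    ∃ w : G.Walk (f 0) (f m), w.length = m ∧ ∀ t ≤ m, w.getVert t = f t := by
  induction m with
  | zero => exact ⟨.nil, rfl, fun t ht => by simp [Nat.le_zero.1 ht]⟩
  | succ m ih =>
    obtain ⟨w, hw, hg⟩ := ih fun t ht => h t (by omega)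
    refine ⟨w.concat (h m (by omega)), by simp [hw], fun t ht => ?_⟩
    rw [SimpleGraph.Walk.concat_eq_append, SimpleGraph.Walk.getVert_append]
    rcases (show t < m ∨ t = m ∨ t = m + 1 by omega) with h | rfl | rfl
    · rw [if_pos (by omega), hg t h.le]
    · simp [hw]
    · simp [hw]

/-- An inner vertex of a new arc has only its two neighbours on the arc, so a walk without
backtracking must continue to the end of the arc. -/
lemma IsPeriodicWalk.traverse {i : ℕ} {f : ℕ → Vtx p.N} {L : ℕ}
    (h : IsPeriodicWalk (SG p (i + 1)) f L) {a b : Vtx p.N} {s t : ℕ}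
    (h0 : 0 < s) (hf : f t = pt p i a b s)
    (hf' : f (t + 1) = pt p i a b (s + 1)) (r : ℕ) (hr : s + r ≤ len p i) :
    f (t + r) = pt p i a b (s + r) := by
  suffices H : ∀ r, s + r + 1 ≤ len p i →
      f (t + r) = pt p i a b (s + r) ∧ f (t + r + 1) = pt p i a b (s + r + 1) by
    rcases Nat.eq_zero_or_pos r with rfl | hr0
    · exact hf
    · obtain ⟨r, rfl⟩ := Nat.exists_eq_add_of_lt hr0
      have := (H r (by omega)).2
      simpa only [zero_add, ← add_assoc] using this
  intro r
  induction r with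
  | zero => exact fun _ => ⟨hf, hf'⟩
  | succ r ih =>
    intro hr
    obtain ⟨i1, i2⟩ := ih (by omega)
    refine ⟨i2, ?_⟩
    have ha := h.adj (t + (r + 1))
    rw [show f (t + (r + 1)) = _ from i2] at ha
    rcases adj_pt_inner (by omega) (by omega) ha with e | e
    · exact absurd (i1.trans e.symm) (h.ne (t + r))
    · exact e

lemma IsPeriodicWalk.exists_arc {i : ℕ} {f : ℕ → Vtx p.N} {L : ℕ}
    (h : IsPeriodicWalk (SG p (i + 1)) f L) {t : ℕ} (ht : i < (f t).tag) :
    ∃ a b s, Joins p i a b ∧ 0 < s ∧ s < len p i ∧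
      ∀ r, s + r ≤ len p i → f (t + r) = pt p i a b (s + r) := by
  rcases mem_SV_succ.1 (adj_mem (h.adj t)) with h1 | ⟨a, b, s, hJ, h0, h1, e⟩ | ⟨-, c, e⟩
  · have := tag_le_of_mem h1; omega
  · have ha := h.adj t
    rw [e] at ha
    rcases adj_pt_inner h0 h1 ha with e1 | e1
    · refine ⟨b, a, len p i - s, joins_symm hJ, by omega, by omega,
        h.traverse (by omega) ?_ ?_⟩
      · rw [e, pt_symm (joins_ne hJ) h1.le]
      · rw [e1, pt_symm (joins_ne hJ) (by omega)]
        congr 1; omega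
    · exact ⟨a, b, s, hJ, h0, h1, h.traverse h0 e e1⟩
  · have ha := h.adj t
    rw [e] at ha
    exact absurd ha iso_not_adj

lemma IsPeriodicWalk.exists_arc_of_old {i : ℕ} {f : ℕ → Vtx p.N} {L : ℕ}
    (h : IsPeriodicWalk (SG p (i + 1)) f L) {t : ℕ} (ht : (f t).tag ≤ i)
    (ht' : i < (f (t + 1)).tag) :
    ∃ a b, Joins p i a b ∧ ∀ r ≤ len p i, f (t + r) = pt p i a b r := by
  obtain ⟨a, b, s, hJ, h0, h1, H⟩ := h.exists_arc ht'
  have e0 := H 0 (by omega)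
  have e1 := H 1 (by omega)
  have ha := (h.adj t).symm
  rw [show f (t + 1) = _ from e0] at ha
  rcases adj_pt_inner (by omega) (by omega) ha with e | e
  · have hs : s = 1 := by
      by_contra hs
      rw [e, tag_pt_inner (by omega) (by omega)] at ht
      omega
    subst hs
    refine ⟨a, b, hJ, fun r hr => ?_⟩
    rcases Nat.eq_zero_or_pos r with rfl | hr0
    · simpa using e
    · have := H (r - 1) (by omega)
      rwa [show t + 1 + (r - 1) = t + r by omega, show 1 + (r - 1) = r by omega] at this
  · exact absurd (e.trans e1.symm) (h.ne t)

lemma exists_step {P : ℕ → Prop} {s t : ℕ} (hst : s ≤ t) (hs : P s) (ht : ¬ P t) :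
    ∃ r, s ≤ r ∧ r < t ∧ P r ∧ ¬ P (r + 1) := by
  induction t, hst using Nat.le_induction with
  | base => exact absurd hs ht
  | succ t hst ih =>
    by_cases h : P t
    · exact ⟨t, hst, by omega, h, ht⟩
    · obtain ⟨r, h1, h2, h3⟩ := ih h
      exact ⟨r, h1, by omega, h3⟩

/-- Induction on the stage. A walk that meets a new arc traverses it completely. If all else is old,
the remainder is a walk between the ends of the arc in the previous stage, and `Joins.far` applies.
Otherwise a second arc is traversed, which gives `L ≥ 2 (n - 1)`. By parity, only `L = 2n - 2` has
to be excluded, and there the second arc would be the first one run backwards. -/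
theorem girth_stage (i : ℕ) {f : ℕ → Vtx p.N} {L : ℕ} (h : IsPeriodicWalk (SG p i) f L) :
    2 * p.n ≤ L := by
  induction i with
  | zero => exact girth_zero h
  | succ i ih =>
    by_cases hall : ∀ t, (f t).tag ≤ i
    · exact ih ⟨h.pos, fun t => adj_of_tag_le (h.adj t) (hall _) (hall _), h.ne, h.per⟩
    push Not at hall
    obtain ⟨t0, ht0⟩ := hall
    have hl := two_le_len p i
    have hnl := n_le_len p i
    -- The walk is rotated so that it starts at an old vertex from which it enters a new arc.
    obtain ⟨g, hs, ht, hL⟩ : ∃ g : ℕ → Vtx p.N, IsPeriodicWalk (SG p (i + 1)) g L ∧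
        (g 0).tag ≤ i ∧ i < (g 1).tag := by
      obtain ⟨a, b, s, hJ, h0, h1, H⟩ := h.exists_arc ht0
      have e := H (len p i - s) (by omega)
      rw [pt_of_len_le (by omega)] at e
      have hb := tag_joins (joins_symm hJ)
      rw [← e] at hb
      -- Adding enough periods to `t0` gives a time after the arc has been left at which the walk is
      -- again at the new vertex `f t0`.
      have hper := h.per_mul (t0 + (len p i - s)) t0
      have hmul : t0 + (len p i - s) ≤ t0 + (t0 + (len p i - s)) * L := by
        have := Nat.le_mul_of_pos_right (t0 + (len p i - s)) h.pos
        omega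
      obtain ⟨r, -, -, h3, h4⟩ := exists_step (P := fun t => (f t).tag ≤ i) hmul hb
        (by rw [hper]; omega)
      exact ⟨_, h.shift r, h3, by simpa using h4⟩
    clear h ht0
    obtain ⟨a, b, hJ, H⟩ := hs.exists_arc_of_old ht hL
    simp only [zero_add] at H
    have hLper : g L = g 0 := by simpa using hs.per 0
    have g0 : g 0 = a := by simpa using H 0 (by omega)
    have gl : g (len p i) = b := by rw [H _ le_rfl, pt_of_len_le le_rfl]
    have hlL : len p i ≤ L := by
      by_contra hlt
      have e := H L (by omega)
      have hpos := hs.pos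
      rw [hLper, g0] at e
      have := tag_joins hJ
      rw [e, tag_pt_inner hs.pos (by omega)] at this
      omega
    by_cases hold : ∀ r, len p i ≤ r → r ≤ L → (g r).tag ≤ i
    · obtain ⟨w, hw, -⟩ := exists_walk (G := SG p i) (fun r => g (len p i + r)) (L - len p i)
        fun r hr => adj_of_tag_le (hs.adj (len p i + r)) (hold _ (by omega) (by omega))
          (hold _ (by omega) (by omega))
      have e1 : g (len p i + 0) = b := gl
      have e2 : g (len p i + (L - len p i)) = a := by
        rw [show len p i + (L - len p i) = L by omega, hLper, g0]
      have := (joins_symm hJ).far (w.copy e1 e2)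
      rw [SimpleGraph.Walk.length_copy, hw] at this
      omega
    · push Not at hold
      obtain ⟨r, hr1, hr2, hr3⟩ := hold
      have hbt := tag_joins (joins_symm hJ)
      rw [← gl] at hbt
      obtain ⟨q, hq1, hq2, hq3, hq4⟩ := exists_step (P := fun t => (g t).tag ≤ i) hr1 hbt (by omega)
      obtain ⟨c, d, hJ', H'⟩ := hs.exists_arc_of_old hq3 (not_le.1 hq4)
      have hqL : q + len p i ≤ L := by
        by_contra hlt
        have e := H' (L - q) (by omega)
        rw [show q + (L - q) = L by omega, hLper, g0] at e
        have := tag_joins hJ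
        rw [e, tag_pt_inner (by omega) (by omega)] at this
        omega
      by_contra hlt
      obtain ⟨L', hL'⟩ := hs.even
      have hq : q = len p i := by omega
      subst hq
      have hLl : L = len p i + len p i := by omega
      have ec : c = b := by
        have := H' 0 (by omega)
        rw [add_zero, gl, pt_zero] at this
        exact this.symm
      have ed : d = a := by
        have := H' (len p i) le_rfl
        rw [← hLl, hLper, g0, pt_of_len_le le_rfl] at this
        exact this.symm
      subst ec ed
      -- The second arc leads from `b` back to `a`, hence retraces the first, and the walk
      -- backtracks at time `len p i`.
      have e1 := H' 1 (by omega)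
      rw [pt_symm (joins_ne hJ') (by omega), ← H _ (by omega)] at e1
      refine hs.ne (len p i - 1) ?_
      rw [show len p i - 1 + 2 = len p i + 1 by omega, e1]

end OpenPolygon

namespace OpenPolygon

/-! ### The polygon -/

variable (p : CycleParams)

/-- The vertices of all stages. -/
abbrev Poly : Type := {v : Vtx p.N // ∃ i, v ∈ SV p i}

/-- The union of the graphs of all stages. -/
def polyGraph : SimpleGraph (Poly p) where
  Adj u v := ∃ i, (SG p i).Adj u.1 v.1
  symm := ⟨fun _ _ ⟨i, h⟩ => ⟨i, h.symm⟩⟩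
  loopless := ⟨fun _ ⟨i, h⟩ => (SG p i).irrefl h⟩

/-- The vertices of colour zero. -/
def polyPoints : Set (Poly p) := {v | v.1.color = 0}

variable {p}

lemma Poly.mem {v : Poly p} {i : ℕ} (h : v.1.tag ≤ i) : v.1 ∈ SV p i := by
  obtain ⟨j, hj⟩ := v.2
  exact mem_of_tag_le hj h

lemma polyGraph_adj_of_tag_le {u v : Poly p} {i : ℕ} (hu : u.1.tag ≤ i) (hv : v.1.tag ≤ i) :
    (polyGraph p).Adj u v ↔ (SG p i).Adj u.1 v.1 :=
  ⟨fun ⟨_, h⟩ => adj_of_tag_le h hu hv, fun h => ⟨i, h⟩⟩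

/-- A vertex of the cycle. -/
def cyc (j : ZMod p.N) : Poly p := ⟨.base j, 0, mem_SV_zero.2 ⟨j, rfl⟩⟩

/-- The vertices of an arc. -/
noncomputable def arcPt {i : ℕ} {a b : Vtx p.N} (h : Joins p i a b) (t : ℕ) : Poly p :=
  ⟨pt p i a b t, i + 1, pt_mem h t⟩

lemma arcPt_val {i : ℕ} {a b : Vtx p.N} (h : Joins p i a b) (t : ℕ) :
    (arcPt h t).1 = pt p i a b t := rfl

lemma arcPt_zero {i : ℕ} {a b : Vtx p.N} (h : Joins p i a b) : (arcPt h 0).1 = a :=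
  pt_zero (i := i) (b := b)

lemma arcPt_len {i : ℕ} {a b : Vtx p.N} (h : Joins p i a b) {t : ℕ} (ht : len p i ≤ t) :
    (arcPt h t).1 = b := pt_of_len_le ht

lemma arcPt_tag {i : ℕ} {a b : Vtx p.N} (h : Joins p i a b) {t : ℕ} (h0 : 0 < t)
    (h1 : t < len p i) : (arcPt h t).1.tag = i + 1 := tag_pt_inner h0 h1

lemma cyc_injective : Function.Injective (cyc (p := p)) := fun _ _ h => by
  have := congrArg Subtype.val h
  injection this

lemma cyc_adj (j : ZMod p.N) : (polyGraph p).Adj (cyc j) (cyc (j + 1)) :=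
  ⟨0, adj_zero.2 ⟨j, rfl, Or.inl rfl⟩⟩

lemma arcPt_adj {i : ℕ} {a b : Vtx p.N} (h : Joins p i a b) {t : ℕ} (ht : t < len p i) :
    (polyGraph p).Adj (arcPt h t) (arcPt h (t + 1)) := ⟨i + 1, adj_pt h ht⟩

lemma arcPt_inj {i : ℕ} {a b : Vtx p.N} (h : Joins p i a b) {s t : ℕ} (hs : s ≤ len p i)
    (ht : t ≤ len p i) (e : arcPt h s = arcPt h t) : s = t :=
  pt_inj h hs ht (congrArg Subtype.val e)

lemma polyGraph_color {u v : Poly p} (h : (polyGraph p).Adj u v) :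
    v.1.color = u.1.color + 1 := adj_color h.choose_spec

lemma color_walk {u v : Poly p} (w : (polyGraph p).Walk u v) :
    v.1.color = u.1.color + w.length := by
  induction w with
  | nil => simp
  | cons h w ih =>
    rw [ih, polyGraph_color h, SimpleGraph.Walk.length_cons]; push_cast; ring

lemma bipartite : (polyGraph p).IsBipartiteWith (polyPoints p) (polyPoints p)ᶜ := by
  refine ⟨disjoint_compl_right, fun u v h => ?_⟩
  have hc := polyGraph_color h
  have : ∀ x y : ZMod 2, y = x + 1 → (x = 0 ∧ ¬ y = 0) ∨ (¬ x = 0 ∧ y = 0) := by decide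
  exact this _ _ hc

/-- A cycle is finite, so it lies in one stage `i`. Its periodic continuation does not backtrack,
also at the base point, and `girth_stage` applies. -/
lemma two_mul_le_length {u : Poly p} {w : (polyGraph p).Walk u u} (hw : w.IsCycle) :
    2 * p.n ≤ w.length := by
  set L := w.length with hL
  have h3 := hw.three_le_length
  set i := (Finset.range (L + 1)).sup fun t => (w.getVert t).1.tag with hi
  have htag : ∀ t ≤ L, (w.getVert t).1.tag ≤ i := fun t ht =>
    Finset.le_sup (f := fun t => (w.getVert t).1.tag) (Finset.mem_range.2 (by omega))
  have hL0 : w.getVert L = w.getVert 0 := by simp [hL]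
  have hnext : ∀ t, w.getVert ((t + 1) % L) = w.getVert (t % L + 1) := by
    intro t
    have hlt : t % L < L := Nat.mod_lt _ (by omega)
    rw [Nat.add_mod, Nat.mod_eq_of_lt (show 1 < L by omega)]
    rcases (show t % L + 1 < L ∨ t % L + 1 = L by omega) with h | h
    · rw [Nat.mod_eq_of_lt h]
    · rw [h, Nat.mod_self, hL0]
  refine girth_stage (p := p) i (f := fun t => (w.getVert (t % L)).1) (L := L)
    ⟨by omega, fun t => ?_, fun t => ?_, fun t => by simp⟩
  · have hlt : t % L < L := Nat.mod_lt _ (by omega)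
    rw [hnext]
    exact (polyGraph_adj_of_tag_le (htag _ hlt.le) (htag _ hlt)).1 (w.adj_getVert_succ hlt)
  · intro e
    have e : w.getVert (t % L) = w.getVert ((t + 2) % L) := Subtype.ext e
    have hlt : t % L < L := Nat.mod_lt _ (by omega)
    rw [show t + 2 = t + 1 + 1 from rfl, hnext (t + 1)] at e
    have hlt' : (t + 1) % L < L := Nat.mod_lt _ (by omega)
    have key := hw.getVert_sub_one_ne_getVert_add_one (i := (t + 1) % L) (by omega)
    rcases Nat.eq_zero_or_pos ((t + 1) % L) with h0 | h0
    · rw [h0] at e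
      have hm : t % L = L - 1 := by
        rw [Nat.add_mod, Nat.mod_eq_of_lt (show 1 < L by omega)] at h0
        by_contra hne
        rw [Nat.mod_eq_of_lt (by omega)] at h0
        omega
      rw [hm] at e
      have := hw.snd_ne_penultimate
      exact this e.symm
    · have hm : (t + 1) % L - 1 = t % L := by
        rw [Nat.add_mod, Nat.mod_eq_of_lt (show 1 < L by omega)] at h0 ⊢
        rcases (show t % L + 1 < L ∨ t % L + 1 = L by omega) with h | h
        · rw [Nat.mod_eq_of_lt h]; omega
        · rw [h, Nat.mod_self] at h0; omega
      rw [hm] at key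
      exact key e

lemma exists_path {V : Type*} {G : SimpleGraph V} (f : ℕ → V) (m : ℕ)
    (h : ∀ t < m, G.Adj (f t) (f (t + 1))) (hf : Set.InjOn f {t | t ≤ m}) :
    ∃ w : G.Walk (f 0) (f m), w.IsPath ∧ w.length = m ∧ ∀ t ≤ m, w.getVert t = f t := by
  obtain ⟨w, hw, hg⟩ := exists_walk f m h
  refine ⟨w, (SimpleGraph.Walk.IsPath.getVert_injOn_iff w).1 fun s hs t ht e => ?_, hw, hg⟩
  change s ≤ _ at hs
  change t ≤ _ at ht
  rw [hw] at hs ht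
  rw [hg s hs, hg t ht] at e
  exact hf hs ht e

/-- A closed path of length `2n` in the polygon. -/
lemma exists_closed_path : ∃ f : ℕ → Poly p, (∀ t, t + 1 < 2 * p.n →
    (polyGraph p).Adj (f t) (f (t + 1))) ∧ (polyGraph p).Adj (f (2 * p.n - 1)) (f 0) ∧
    Set.InjOn f {t | t < 2 * p.n} := by
  have hJ : Joins p 0 (.base (p.k : ZMod p.N)) (.base ((p.k : ZMod p.N) + p.k)) :=
    joins_zero.2 ⟨_, rfl, rfl⟩
  have hl : len p 0 = 2 * p.h := rfl
  have := p.sum_eq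
  have := p.one_le_h
  have := p.N_eq
  have := p.n_le_k
  have := p.three_le
  -- Half of the cycle, from `0` to `k`, followed by the arc from `k` to its antipode `k + k = 0`.
  -- The total length is `k + 2h = 2n`.
  refine ⟨fun t => if t ≤ p.k then cyc (t : ZMod p.N) else arcPt hJ (t - p.k), fun t ht => ?_,
    ?_, ?_⟩
  · dsimp only
    rcases (show t + 1 ≤ p.k ∨ t = p.k ∨ p.k < t by omega) with h | rfl | h
    · rw [if_pos (by omega), if_pos h]
      push_cast
      exact cyc_adj _
    · rw [if_pos le_rfl, if_neg (by omega)]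
      have := arcPt_adj hJ (t := 0) (by omega)
      convert this using 1
      · exact Subtype.ext (arcPt_zero hJ).symm
      · congr 1; omega
    · rw [if_neg (by omega), if_neg (by omega)]
      have := arcPt_adj hJ (t := t - p.k) (by omega)
      convert this using 2
      omega
  · dsimp only
    rw [if_neg (by omega), if_pos (by omega)]
    have := arcPt_adj hJ (t := 2 * p.n - 1 - p.k) (by omega)
    convert this using 1
    refine Subtype.ext ?_
    rw [arcPt_len hJ (by omega), p.k_add_k]
    simp [cyc]
  · intro s hs t ht e
    change s < _ at hs
    change t < _ at ht
    have tagc : ∀ j : ZMod p.N, (cyc j).1.tag = 0 := fun _ => rfl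
    have taga : ∀ s, p.k < s → s < 2 * p.n → (arcPt hJ (s - p.k)).1.tag = 1 := fun s h1 h2 =>
      arcPt_tag hJ (by omega) (by omega)
    dsimp only at e
    split_ifs at e with h1 h2 h2
    · exact (p.natCast_eq_iff (by omega) (by omega)).1 (cyc_injective e)
    · have := congrArg (fun v : Poly p => v.1.tag) e
      simp only [tagc, taga t (by omega) ht] at this
      omega
    · have := congrArg (fun v : Poly p => v.1.tag) e
      simp only [tagc, taga s (by omega) hs] at this
      omega
    · have := arcPt_inj hJ (by omega) (by omega) e
      omega

/-! ### Girth, thickness and diameter of the polygon -/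

lemma egirth_eq : (polyGraph p).egirth = 2 * p.n := by
  refine le_antisymm ?_ (SimpleGraph.le_egirth.2 fun u w hw => by
    exact_mod_cast two_mul_le_length hw)
  have := p.three_le
  obtain ⟨f, h1, h2, h3⟩ := exists_closed_path (p := p)
  obtain ⟨w, hw, hl, -⟩ := exists_path f (2 * p.n - 1) (fun t ht => h1 t (by omega))
    (h3.mono fun t ht => by change t ≤ _ at ht; change t < _; omega)
  have hc : (SimpleGraph.Walk.cons h2 w).IsCycle := by
    rw [SimpleGraph.Walk.isCycle_iff_isPath_tail_and_le_length]
    refine ⟨by simpa using hw, ?_⟩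
    rw [SimpleGraph.Walk.length_cons, hl]; omega
  have := SimpleGraph.egirth_le_length hc
  rw [SimpleGraph.Walk.length_cons, hl, show 2 * p.n - 1 + 1 = 2 * p.n by omega] at this
  exact_mod_cast this

lemma eq_iso_of_walk {i : ℕ} {c : ZMod 2} {u v : Vtx p.N} (w : (SG p (i + 1)).Walk u v)
    (hu : u = .iso i c) : v = .iso i c := by
  cases w with
  | nil => exact hu
  | cons h _ => exact absurd (hu ▸ h) iso_not_adj

/-- An isolated vertex is reached by no walk from another vertex, so the length condition is
vacuous. Every vertex thus gets a new neighbour at each sufficiently late stage, which gives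
thickness. -/
lemma joins_iso {v : Poly p} {m : ℕ} (hm : 1 ≤ m) (hv : v.1.tag ≤ m) :
    Joins p (m + 1) v.1 (.iso m (v.1.color + (len p (m + 1) : ℕ))) := by
  have hne : v.1 ≠ .iso m (v.1.color + (len p (m + 1) : ℕ)) := by
    intro e
    have := congrArg Vtx.tag e
    change _ = m + 1 at this
    omega
  refine (joins_of_pos m.succ_pos).2 ⟨v.mem (by omega),
    mem_SV_succ.2 (Or.inr (Or.inr ⟨hm, _, rfl⟩)),
    rfl, fun w => ?_⟩
  exact absurd (eq_iso_of_walk w.reverse rfl) hne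

lemma thick (v : Poly p) : 3 ≤ ((polyGraph p).neighborSet v).encard := by
  have H : ∀ m, 1 ≤ m → v.1.tag ≤ m → ∃ u, (polyGraph p).Adj v u ∧ u.1.tag = m + 2 := by
    intro m hm hv
    have hl := two_le_len p (m + 1)
    have hJ := joins_iso hm hv
    refine ⟨arcPt hJ 1, ?_, arcPt_tag hJ (by omega) (by omega)⟩
    have := arcPt_adj hJ (t := 0) (by omega)
    convert this using 1
    exact Subtype.ext (arcPt_zero hJ).symm
  obtain ⟨a, ha, ha'⟩ := H (v.1.tag + 1) (by omega) (by omega)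
  obtain ⟨b, hb, hb'⟩ := H (v.1.tag + 2) (by omega) (by omega)
  obtain ⟨c, hc, hc'⟩ := H (v.1.tag + 3) (by omega) (by omega)
  have hab : a ≠ b := by rintro rfl; omega
  have hac : a ≠ c := by rintro rfl; omega
  have hbc : b ≠ c := by rintro rfl; omega
  have h3 : ({a, b, c} : Set (Poly p)).encard = 3 :=
    Set.encard_eq_three.2 ⟨a, b, c, hab, hac, hbc, rfl⟩
  rw [← h3]
  refine Set.encard_le_encard ?_
  rintro x (rfl | rfl | rfl)
  · exact ha
  · exact hb
  · exact hc

lemma exists_walk_of_stage {i : ℕ} {a b : Vtx p.N} (w : (SG p i).Walk a b) :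
    ∀ u v : Poly p, u.1 = a → v.1 = b → ∃ w' : (polyGraph p).Walk u v, w'.length = w.length := by
  induction w with
  | nil =>
    rintro u v rfl hv
    obtain rfl : v = u := Subtype.ext hv
    exact ⟨.nil, rfl⟩
  | cons h w ih =>
    rintro u v rfl rfl
    obtain ⟨w', hw'⟩ := ih ⟨_, i, adj_mem h.symm⟩ v rfl rfl
    exact ⟨.cons ⟨i, h⟩ w', congrArg (· + 1) hw'⟩

/-- At a stage `i` that contains both vertices, either there is a walk of length at most `n`, and
parity excludes length exactly `n`, or an arc of length `n - 1` is added between them. -/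
lemma exists_walk_le {u v : Poly p} (hc : v.1.color = u.1.color + (p.n - 1 : ℕ)) :
    ∃ w : (polyGraph p).Walk u v, w.length ≤ p.n - 1 := by
  have h3 := p.three_le
  set i := max u.1.tag v.1.tag + 1 with hi
  have hl : len p i = p.n - 1 := by rw [len, if_neg (by omega)]
  by_cases hw : ∃ w : (SG p i).Walk u.1 v.1, w.length ≤ p.n
  · obtain ⟨w, hw⟩ := hw
    obtain ⟨w', hw'⟩ := exists_walk_of_stage w u v rfl rfl
    refine ⟨w', ?_⟩
    have hcol := color_walk w'
    rw [hw'] at hcol ⊢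
    rw [hc, add_right_inj] at hcol
    by_contra hlt
    have hn : w.length = p.n := by omega
    rw [hn] at hcol
    have : ((p.n : ℕ) : ZMod 2) = (p.n - 1 : ℕ) + 1 := by
      rw [← Nat.cast_succ]; congr 1; omega
    rw [this, left_eq_add] at hcol
    exact absurd hcol (by decide)
  · push Not at hw
    have hJ : Joins p i u.1 v.1 := (joins_of_pos (by omega)).2
      ⟨u.mem (by omega), v.mem (by omega), by rw [hl, hc], hw⟩
    obtain ⟨w, hw, -⟩ := exists_walk (G := polyGraph p) (arcPt hJ) (len p i)
      fun t ht => arcPt_adj hJ ht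
    refine ⟨w.copy (Subtype.ext (arcPt_zero hJ)) (Subtype.ext (arcPt_len hJ le_rfl)), ?_⟩
    rw [SimpleGraph.Walk.length_copy, hw, hl]

lemma ediam_eq : (polyGraph p).ediam = p.n := by
  have h3 := p.three_le
  refine le_antisymm (SimpleGraph.ediam_le_of_edist_le fun u v => ?_) ?_
  · obtain ⟨w, hw⟩ : ∃ w : (polyGraph p).Walk u v, w.length ≤ p.n := by
      by_cases hc : v.1.color = u.1.color + (p.n - 1 : ℕ)
      · obtain ⟨w, hw⟩ := exists_walk_le hc
        exact ⟨w, by omega⟩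
      -- With the wrong parity, a neighbour of `v` has the right one and costs one more step.
      · obtain ⟨v', hv'⟩ : ((polyGraph p).neighborSet v).Nonempty := by
          rw [← Set.encard_pos]
          exact lt_of_lt_of_le (by norm_num) (thick v)
        change (polyGraph p).Adj v v' at hv'
        have hc' : v'.1.color = u.1.color + (p.n - 1 : ℕ) := by
          rw [polyGraph_color hv']
          generalize v.1.color = x at hc
          generalize u.1.color + (p.n - 1 : ℕ) = y at hc
          revert x y; decide
        obtain ⟨w, hw⟩ := exists_walk_le hc'
        exact ⟨w.concat hv'.symm, by rw [SimpleGraph.Walk.length_concat]; omega⟩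
    exact (SimpleGraph.edist_le w).trans (by exact_mod_cast hw)
  · obtain ⟨f, h1, h2, h3⟩ := exists_closed_path (p := p)
    obtain ⟨w, hw, hl, -⟩ := exists_path f p.n (fun t ht => h1 t (by omega))
      (h3.mono fun t ht => by change t ≤ _ at ht; change t < _; omega)
    refine le_trans ?_ (SimpleGraph.edist_le_ediam (u := f 0) (v := f p.n))
    by_contra hlt
    rw [not_le] at hlt
    obtain ⟨q, hq⟩ := SimpleGraph.exists_walk_of_edist_ne_top (ne_top_of_lt hlt)
    have hq' : q.length < p.n := by rw [← hq] at hlt; exact_mod_cast hlt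
    classical
    have hb := q.length_bypass_le_length
    -- A path shorter than `n` between opposite vertices of a `2n`-cycle would form, together with
    -- half of that cycle, a cycle of length less than `2n`.
    obtain ⟨x, -, -, c, hc, hcl⟩ := hw.exists_isCycle_length_le_add_of_ne q.bypass_isPath
      (by rintro rfl; omega)
    have := two_mul_le_length hc
    omega

theorem isGeneralizedPolygon : IsGeneralizedPolygon p.n (polyGraph p) (polyPoints p) :=
  ⟨bipartite, ediam_eq, egirth_eq, thick⟩

end OpenPolygon

namespace OpenPolygon

/-! ### Arcs and closed sets -/

/-- A path `q 0, …, q l` whose inner vertices have no other neighbours in `S`. -/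
structure IsArc {V : Type*} (G : SimpleGraph V) (S : Set V) (q : ℕ → V) (l : ℕ) : Prop where
  inj : ∀ s ≤ l, ∀ t ≤ l, q s = q t → s = t
  adj : ∀ t < l, G.Adj (q t) (q (t + 1))
  nbr : ∀ t, 0 < t → t < l → ∀ w ∈ S, G.Adj (q t) w → w = q (t - 1) ∨ w = q (t + 1)

section

variable {V : Type*} {G : SimpleGraph V} {S S' A B : Set V} {q : ℕ → V} {l n : ℕ}

lemma IsArc.valencyIn_eq (h : IsArc G S q l) (hS : S' ⊆ S) {t : ℕ} (h0 : 0 < t) (h1 : t < l)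
    (hl : q (t - 1) ∈ S') (hr : q (t + 1) ∈ S') : valencyIn G S' (q t) = 2 := by
  have hne : q (t - 1) ≠ q (t + 1) := fun e => by
    have := h.inj (t - 1) (by omega) (t + 1) (by omega) e
    omega
  rw [valencyIn, ← Set.encard_pair hne]
  congr 1
  ext w
  constructor
  · rintro ⟨h2, h3⟩
    exact h.nbr t h0 h1 w (hS h3) h2
  · rintro (rfl | rfl)
    · refine ⟨?_, hl⟩
      have := h.adj (t - 1) (by omega)
      rw [show t - 1 + 1 = t by omega] at this
      exact this.symm
    · exact ⟨h.adj t h1, hr⟩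

lemma IsArc.isCleanArc (h : IsArc G S q l) (hS : S' ⊆ S) (hn : n ≤ l + 1) {x y : V}
    (w : G.Walk x y) (hw : w.length + 1 = n) (hg : ∀ t < n, w.getVert t = q t)
    (hq : ∀ t < n, q t ∈ S') : IsCleanArc n G S' w := by
  refine ⟨(SimpleGraph.Walk.IsPath.getVert_injOn_iff w).1 fun s hs t ht e => ?_, hw,
    fun v hv => ?_, fun j hj1 hj2 => ?_⟩
  · change s ≤ _ at hs
    change t ≤ _ at ht
    rw [hg s (by omega), hg t (by omega)] at e
    exact h.inj s (by omega) t (by omega) e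
  · obtain ⟨t, rfl, ht⟩ := SimpleGraph.Walk.mem_support_iff_exists_getVert.1 hv
    rw [hg t (by omega)]
    exact hq t (by omega)
  · rw [hg j (by omega)]
    exact h.valencyIn_eq hS (by omega) (by omega) (hq _ (by omega)) (hq _ (by omega))

/-- A set that meets an arc outside of `A` is not closed over `A`. -/
lemma IsArc.not_isClosedOver (h : IsArc G S q l) (hS : A ∪ B ⊆ S) (h3 : 3 ≤ n) (hn : n ≤ l + 1)
    (hA : ∀ t, 0 < t → t < l → q t ∉ A) {t : ℕ} (h0 : 0 < t) (h1 : t < l) (hB : q t ∈ B) :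
    ¬ IsClosedOver n G A B := by
  rintro ⟨-, hloose, hclean⟩
  have inB : ∀ t, 0 < t → t < l → q t ∈ A ∪ B → q t ∈ B := fun t h0 h1 ht =>
    ht.resolve_left (hA t h0 h1)
  by_cases hall : ∀ s ≤ l, q s ∈ A ∪ B
  -- If the whole arc is present, its initial piece of length `n - 1` is a clean arc with inner
  -- vertices in `B`.
  · obtain ⟨w, hw, hg⟩ := exists_walk (G := G) q (n - 1) fun t ht => h.adj t (by omega)
    refine hclean _ _ w (h.isCleanArc hS hn w (by omega) (fun t ht => hg t (by omega))
      fun t ht => hall t (by omega)) fun j hj1 hj2 => ?_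
    rw [hg j (by omega)]
    exact inB j (by omega) (by omega) (hall j (by omega))
  · push Not at hall
    obtain ⟨s, hs, hsn⟩ := hall
    have hts : t ≠ s := by rintro rfl; exact hsn (Or.inr hB)
    -- Otherwise, moving along the arc from `q t` to a missing vertex, the last vertex still present
    -- is a loose end in `B`.
    have key : ∀ r, 0 < r → r < l → q r ∈ B → q (r - 1) ∉ A ∪ B ∨ q (r + 1) ∉ A ∪ B → False := by
      intro r hr0 hr1 hr hor
      refine hloose _ hr ⟨Or.inr hr, ?_⟩
      rw [valencyIn, Set.encard_le_one_iff]
      rintro a b ⟨ha, ha'⟩ ⟨hb, hb'⟩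
      rcases h.nbr r hr0 hr1 a (hS ha') ha with rfl | rfl <;>
        rcases h.nbr r hr0 hr1 b (hS hb') hb with rfl | rfl <;>
        rcases hor with hor | hor <;> first | rfl | exact absurd ‹_› hor
    rcases lt_or_gt_of_ne hts with hlt | hlt
    · obtain ⟨r, r1, r2, r3, r4⟩ := exists_step (P := fun r => q r ∈ A ∪ B) hlt.le (Or.inr hB) hsn
      exact key r (by omega) (by omega) (inB r (by omega) (by omega) r3) (Or.inr r4)
    · obtain ⟨r, r1, r2, r3, r4⟩ := exists_step (P := fun r => q r ∉ A ∪ B) hlt.le hsn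
        (not_not.2 (Or.inr hB))
      exact key (r + 1) (by omega) (by omega) (inB (r + 1) (by omega) (by omega) (not_not.1 r4))
        (Or.inl r3)

end

/-! ### Strong subsets and openness of the polygon -/

variable {p : CycleParams}

variable (p) in
/-- The vertices that are added before stage `i + 1`. -/
def tagLE (i : ℕ) : Set (Poly p) := {v | v.1.tag ≤ i}

lemma Joins.isArc {i : ℕ} {a b : Vtx p.N} (h : Joins p i a b) :
    IsArc (polyGraph p) (tagLE p (i + 1)) (arcPt h) (len p i) := by
  refine ⟨fun s hs t ht e => arcPt_inj h hs ht e, fun t ht => arcPt_adj h ht,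
    fun t h0 h1 w hw ha => ?_⟩
  rw [polyGraph_adj_of_tag_le (arcPt_tag h h0 h1).le hw] at ha
  rcases adj_pt_inner h0 h1 ha with e | e
  · exact Or.inl (Subtype.ext e)
  · exact Or.inr (Subtype.ext e)

/-- A vertex is an isolated vertex or an inner vertex of an arc, at the stage where it is added. -/
lemma exists_arc_of_tag_eq {v : Poly p} {i : ℕ} (hv : v.1.tag = i + 1) :
    (∃ a b, ∃ h : Joins p i a b, ∃ t, 0 < t ∧ t < len p i ∧ v = arcPt h t) ∨
      (1 ≤ i ∧ ∃ c, v.1 = .iso i c) := by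
  rcases mem_SV_succ.1 (v.mem hv.le) with h | ⟨a, b, t, hJ, h0, h1, e⟩ | h
  · have := tag_le_of_mem h; omega
  · exact Or.inl ⟨a, b, hJ, t, h0, h1, Subtype.ext e⟩
  · exact Or.inr h

lemma eq_cyc_of_tag {v : Poly p} (hv : v.1.tag = 0) : ∃ j, v = cyc j := by
  obtain ⟨j, hj⟩ := mem_SV_zero.1 (v.mem hv.le)
  exact ⟨j, Subtype.ext hj⟩

/-- Strongness only has to be verified at the first stage. -/
lemma isStrong_of_tagLE {Z : Set (Poly p)} (hZ : Z ⊆ tagLE p 1)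
    (H : ∀ B : Set (Poly p), B ⊆ tagLE p 1 → B.Nonempty → ¬ IsClosedOver p.n (polyGraph p) Z B) :
    IsStrong p.n (polyGraph p) Z := by
  intro B hfin hne
  by_cases hB : B ⊆ tagLE p 1
  · exact H B hB hne
  -- All of `Z ∪ B` is present by the stage that adds a vertex `v` of maximal tag. Hence `v` lies on
  -- an arc that is unbranched relative to `Z ∪ B`, or it is isolated there and so a loose end.
  obtain ⟨v, hv, hmax⟩ := Set.exists_max_image B (fun v => v.1.tag) hfin hne
  obtain ⟨u, hu, hu1⟩ := Set.not_subset.1 hB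
  have hu2 := hmax u hu
  change ¬ u.1.tag ≤ 1 at hu1
  obtain ⟨i, hi⟩ : ∃ i, v.1.tag = i + 1 := ⟨v.1.tag - 1, by omega⟩
  have hsub : Z ∪ B ⊆ tagLE p (i + 1) := by
    rintro w (hw | hw)
    · have : w.1.tag ≤ 1 := hZ hw
      change w.1.tag ≤ i + 1; omega
    · have := hmax w hw
      change w.1.tag ≤ i + 1; omega
  rcases exists_arc_of_tag_eq hi with ⟨a, b, h, t, h0, h1, rfl⟩ | ⟨-, c, hc⟩
  · refine h.isArc.not_isClosedOver hsub p.three_le (n_le_len p i) (fun s hs0 hs1 hs => ?_) h0 h1 hv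
    have : (arcPt h s).1.tag ≤ 1 := hZ hs
    rw [arcPt_tag h hs0 hs1] at this
    omega
  · rintro ⟨-, hloose, -⟩
    refine hloose v hv ⟨Or.inr hv, ?_⟩
    rw [valencyIn, Set.encard_le_one_iff]
    rintro x - ⟨hx, hx'⟩ -
    have hx : (polyGraph p).Adj v x := hx
    rw [polyGraph_adj_of_tag_le hi.le (hsub hx'), hc] at hx
    exact absurd hx iso_not_adj

lemma isStrong_tagLE_one : IsStrong p.n (polyGraph p) (tagLE p 1) :=
  isStrong_of_tagLE subset_rfl fun _ hB ⟨_, hv⟩ h =>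
    Set.disjoint_left.1 h.1 (hB hv) hv

lemma joins_cyc (j : ZMod p.N) : Joins p 0 (.base j) (.base (j + p.k)) := joins_zero.2 ⟨j, rfl, rfl⟩

lemma exists_natCast_lt_k (j : ZMod p.N) :
    ∃ i : ℕ, i < p.k ∧ (j = i ∨ j = (i : ZMod p.N) + p.k) := by
  have h1 := ZMod.val_lt j
  have h2 := ZMod.natCast_zmod_val j
  have := p.N_eq
  by_cases h : j.val < p.k
  · exact ⟨_, h, Or.inl h2.symm⟩
  · refine ⟨j.val - p.k, by omega, Or.inr ?_⟩
    rw [← Nat.cast_add, Nat.sub_add_cancel (by omega), h2]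

/-- The vertices of the first stage outside of the cycle. -/
lemma exists_arc_of_tag_eq_one {v : Poly p} (hv : v.1.tag = 1) :
    ∃ i : ℕ, i < p.k ∧ ∃ t, 0 < t ∧ t < len p 0 ∧ v = arcPt (joins_cyc (i : ZMod p.N)) t := by
  rcases exists_arc_of_tag_eq hv with ⟨a, b, h, t, h0, h1, rfl⟩ | ⟨h, -⟩
  · obtain ⟨j, rfl, rfl⟩ := joins_zero.1 h
    obtain ⟨i, hi, rfl | rfl⟩ := exists_natCast_lt_k j
    · exact ⟨i, hi, t, h0, h1, rfl⟩
    · refine ⟨i, hi, len p 0 - t, by omega, by omega, Subtype.ext ?_⟩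
      rw [arcPt_val, arcPt_val, pt_symm (joins_ne h) h1.le, add_assoc, p.k_add_k, add_zero]
  · omega

lemma tag_cyc (j : ZMod p.N) : (cyc j).1.tag = 0 := rfl

lemma range_cyc_subset : Set.range (cyc (p := p)) ⊆ tagLE p 1 := by
  rintro _ ⟨j, rfl⟩
  exact (tag_cyc j).le.trans zero_le_one

lemma isStrong_cyc : IsStrong p.n (polyGraph p) (Set.range cyc) := by
  refine isStrong_of_tagLE range_cyc_subset fun B hB ⟨v, hv⟩ hcl => ?_
  have hv1 : v.1.tag ≤ 1 := hB hv
  rcases Nat.eq_zero_or_pos v.1.tag with h0 | h0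
  · obtain ⟨j, rfl⟩ := eq_cyc_of_tag h0
    exact Set.disjoint_left.1 hcl.1 ⟨j, rfl⟩ hv
  · obtain ⟨i, -, t, ht0, ht1, rfl⟩ := exists_arc_of_tag_eq_one (v := v) (by omega)
    refine (joins_cyc (i : ZMod p.N)).isArc.not_isClosedOver (Set.union_subset range_cyc_subset hB)
      p.three_le (n_le_len p 0) ?_ ht0 ht1 hv hcl
    rintro s hs0 hs1 ⟨j, hj⟩
    have := arcPt_tag (joins_cyc (i : ZMod p.N)) hs0 hs1
    rw [← hj, tag_cyc] at this
    omega

lemma isArc_cyc (j : ZMod p.N) :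
    IsArc (polyGraph p) (tagLE p 0) (fun t => cyc (j + t)) (p.N - 1) := by
  refine ⟨fun s hs t ht e => ?_, fun t _ => ?_, fun t h0 _ w hw ha => ?_⟩
  · have := p.N_eq; have := p.n_le_k; have := p.three_le
    have := cyc_injective e
    rw [add_right_inj] at this
    exact (p.natCast_eq_iff (by omega) (by omega)).1 this
  · push_cast
    rw [← add_assoc]
    exact cyc_adj _
  · rw [polyGraph_adj_of_tag_le (i := 0) (tag_cyc _).le hw] at ha
    obtain ⟨j', e, e'⟩ := adj_zero.1 ha
    injection e with e
    subst e
    rcases e' with e' | e'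
    · exact Or.inr (Subtype.ext (by rw [e']; simp [cyc, add_assoc]))
    · refine Or.inl (Subtype.ext ?_)
      rw [e', Nat.cast_sub h0]; simp [cyc, add_sub_assoc]

lemma isStrong_empty : IsStrong p.n (polyGraph p) ∅ := by
  have := p.N_eq; have := p.n_le_k; have := p.three_le
  refine isStrong_of_tagLE (Set.empty_subset _) fun B hB ⟨v, hv⟩ => ?_
  by_cases h : ∃ v ∈ B, v.1.tag = 1
  · obtain ⟨v, hv, hv1⟩ := h
    obtain ⟨i, -, t, ht0, ht1, rfl⟩ := exists_arc_of_tag_eq_one hv1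
    exact (joins_cyc (i : ZMod p.N)).isArc.not_isClosedOver
      (Set.union_subset (Set.empty_subset _) hB)
      p.three_le (n_le_len p 0) (fun _ _ _ => id) ht0 ht1 hv
  · push Not at h
    have hB0 : B ⊆ tagLE p 0 := fun u hu => by
      have h1 : u.1.tag ≤ 1 := hB hu
      have h2 := h u hu
      change u.1.tag ≤ 0
      omega
    obtain ⟨j, rfl⟩ := eq_cyc_of_tag (Nat.le_zero.1 (hB0 hv))
    -- A set inside the cycle is handled by cutting the cycle open to a path of length `N - 1`,
    -- placed so that `cyc j` is its second vertex.
    refine (isArc_cyc (j - 1)).not_isClosedOver (Set.union_subset (Set.empty_subset _) hB0)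
      p.three_le (by omega) (fun _ _ _ => id) (t := 1) one_pos (by omega) ?_
    simpa using hv

/-- Openness is strongness of the empty set. -/
theorem isOpenGraph : IsOpenGraph p.n (polyGraph p) := by
  intro C hfin hne
  by_contra hcon
  push Not at hcon
  have h3 := p.three_le
  refine isStrong_empty C hfin hne ⟨Set.empty_disjoint _, fun v _ => ?_, fun x y w hw => ?_⟩
  · rw [Set.empty_union]; exact hcon.1 v
  · rw [Set.empty_union] at hw; exact absurd hw (hcon.2 x y w)

theorem isOpenPolygon : IsOpenPolygon p.n (polyGraph p) (polyPoints p) :=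
  ⟨isGeneralizedPolygon, isOpenGraph⟩

/-- The cycle together with the first inner vertices of half of the oriented arcs. -/
lemma isStrong_cyc_union (hlen : p.n ≤ len p 0) :
    IsStrong p.n (polyGraph p) (Set.range cyc ∪
      {v | ∃ i : ℕ, i < p.k ∧ v = arcPt (joins_cyc (i : ZMod p.N)) 1}) := by
  have hl := two_le_len p 0
  have hk := p.N_eq
  have hsub : Set.range cyc ∪ {v | ∃ i : ℕ, i < p.k ∧ v = arcPt (joins_cyc (i : ZMod p.N)) 1} ⊆
      tagLE p 1 := by
    refine Set.union_subset range_cyc_subset ?_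
    rintro _ ⟨i, -, rfl⟩
    exact (arcPt_tag _ (by omega) (by omega)).le
  refine isStrong_of_tagLE hsub fun B hB ⟨v, hv⟩ hcl => ?_
  have hv1 : v.1.tag ≤ 1 := hB hv
  rcases Nat.eq_zero_or_pos v.1.tag with h0 | h0
  · obtain ⟨j, rfl⟩ := eq_cyc_of_tag h0
    exact Set.disjoint_left.1 hcl.1 (Or.inl ⟨j, rfl⟩) hv
  obtain ⟨i, hi, t, ht0, ht1, rfl⟩ := exists_arc_of_tag_eq_one (v := v) (by omega)
  have harc := (joins_cyc (i : ZMod p.N)).isArc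
  have ht : t ≠ 1 := by
    rintro rfl
    exact Set.disjoint_left.1 hcl.1 (Or.inr ⟨i, hi, rfl⟩) hv
  -- The first inner vertex now belongs to the base set, so it serves as an endpoint. The rest of
  -- the arc still has length at least `n - 1` by `hlen`.
  have harc' : IsArc (polyGraph p) (tagLE p 1) (fun s => arcPt (joins_cyc (i : ZMod p.N)) (s + 1))
      (len p 0 - 1) := by
    refine ⟨fun s hs s' hs' e => ?_, fun s hs => harc.adj (s + 1) (by omega),
      fun s h0 h1 w hw ha => ?_⟩
    · have := harc.inj (s + 1) (by omega) (s' + 1) (by omega) e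
      omega
    · have := harc.nbr (s + 1) (by omega) (by omega) w hw ha
      rwa [show s + 1 - 1 = s - 1 + 1 by omega] at this
  refine harc'.not_isClosedOver (Set.union_subset hsub hB) p.three_le (by omega) ?_
    (t := t - 1) (by omega) (by omega) (by rwa [Nat.sub_add_cancel ht0]) hcl
  rintro s hs0 hs1 (⟨j, hj⟩ | ⟨i', hi', e⟩)
  · have := arcPt_tag (joins_cyc (i : ZMod p.N)) (t := s + 1) (by omega) (by omega)
    rw [← hj, tag_cyc] at this
    omega
  · have e := congrArg Subtype.val e
    rw [arcPt_val, arcPt_val] at e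
    -- Only one of the two vertices next to the ends of an arc has been added: the other one would
    -- need `i = i' + k` modulo `N` with `i, i' < k`.
    rcases pt_inner_inj (by omega) (by omega) (by omega) (by omega) e with ⟨-, -, e⟩ | ⟨e, -, -⟩
    · omega
    · injection e with e
      rw [← Nat.cast_add, p.natCast_eq_iff (by omega) (by omega)] at e
      omega

end OpenPolygon

namespace OpenPolygon

/-! ### Embeddings of the first stage -/

section

variable {V : Type*} {G : SimpleGraph V} {S : Set V}

lemma eq_or_eq_of_valencyIn_eq_two {v x y z : V} (h : valencyIn G S v = 2) (hxy : x ≠ y)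
    (hx : x ∈ S) (hx' : G.Adj v x) (hy : y ∈ S) (hy' : G.Adj v y) (hz : z ∈ S)
    (hz' : G.Adj v z) : z = x ∨ z = y := by
  have hsub : ({x, y} : Set V) ⊆ G.neighborSet v ∩ S := by
    rintro _ (rfl | rfl)
    · exact ⟨hx', hx⟩
    · exact ⟨hy', hy⟩
  have := (Set.toFinite _).eq_of_subset_of_encard_le hsub (by
    rw [Set.encard_pair hxy]; exact h.le)
  have hz2 : z ∈ G.neighborSet v ∩ S := ⟨hz', hz⟩
  rwa [← this] at hz2

end

variable {p : CycleParams}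

lemma arcPt_mem_tagLE {i : ℕ} {a b : Vtx p.N} (h : Joins p i a b) (t : ℕ) :
    arcPt h t ∈ tagLE p (i + 1) := tag_le_of_mem (pt_mem h t)

lemma finite_tagLE_one : (tagLE p 1).Finite := by
  have : tagLE p 1 ⊆ Set.range cyc ∪
      ⋃ j : ZMod p.N, (arcPt (joins_cyc j)) '' Set.Iio (len p 0) := by
    intro v hv
    change v.1.tag ≤ 1 at hv
    rcases Nat.eq_zero_or_pos v.1.tag with h0 | h0
    · obtain ⟨j, rfl⟩ := eq_cyc_of_tag h0
      exact Or.inl ⟨j, rfl⟩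
    · obtain ⟨i, -, t, -, ht, rfl⟩ := exists_arc_of_tag_eq_one (v := v) (by omega)
      exact Or.inr (Set.mem_iUnion.2 ⟨i, t, ht, rfl⟩)
  refine Set.Finite.subset ((Set.finite_range _).union (Set.finite_iUnion fun j => ?_)) this
  exact (Set.finite_Iio _).image _

instance : Finite (tagLE p 1) := finite_tagLE_one

variable (p) in
/-- The midpoints of the arcs of the first stage. -/
def mids : Set (Poly p) := {v | ∃ j : ZMod p.N, v = arcPt (joins_cyc j) p.h}

lemma mids_subset : mids p ⊆ tagLE p 1 := by
  rintro _ ⟨j, rfl⟩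
  exact arcPt_mem_tagLE _ _

/-- The embeddings of the first stage into the polygon that fix all midpoints. -/
structure IsEmb (g : tagLE p 1 → Poly p) : Prop where
  inj : ∀ c d, g c = g d → c = d
  adj : ∀ c d : tagLE p 1, (polyGraph p).Adj c.1 d.1 → (polyGraph p).Adj (g c) (g d)
  fix : ∀ c : tagLE p 1, c.1 ∈ mids p → g c = c.1

lemma one_ne_neg_one : (1 : ZMod p.N) ≠ -1 := by
  have := p.N_eq; have := p.n_le_k; have := p.three_le
  intro h
  have h2 : ((2 : ℕ) : ZMod p.N) = (0 : ℕ) := by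
    push_cast; linear_combination h
  rw [p.natCast_eq_iff (by omega) (by omega)] at h2
  omega

/-- The vertices of the cycle have three neighbours in the first stage. -/
lemma exists_three_nbrs (j : ZMod p.N) : ∃ x y z : tagLE p 1, x ≠ y ∧ z ≠ x ∧ z ≠ y ∧
    (polyGraph p).Adj (cyc j) x.1 ∧ (polyGraph p).Adj (cyc j) y.1 ∧
    (polyGraph p).Adj (cyc j) z.1 := by
  have hl := two_le_len p 0
  have htag := arcPt_tag (joins_cyc j) (t := 1) (by omega) (by omega)
  refine ⟨⟨cyc (j + 1), range_cyc_subset ⟨_, rfl⟩⟩, ⟨cyc (j - 1), range_cyc_subset ⟨_, rfl⟩⟩,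
    ⟨arcPt (joins_cyc j) 1, arcPt_mem_tagLE _ _⟩, ?_, ?_, ?_, cyc_adj j, ?_, ?_⟩
  · intro e
    have e := cyc_injective (congrArg Subtype.val e)
    rw [sub_eq_add_neg, add_right_inj] at e
    exact one_ne_neg_one e
  · intro e
    rw [show arcPt (joins_cyc j) 1 = _ from congrArg Subtype.val e, tag_cyc] at htag
    omega
  · intro e
    rw [show arcPt (joins_cyc j) 1 = _ from congrArg Subtype.val e, tag_cyc] at htag
    omega
  · have := cyc_adj (j - 1)
    rw [sub_add_cancel] at this
    exact this.symm
  · have := arcPt_adj (joins_cyc j) (t := 0) (by omega)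
    rwa [show arcPt (joins_cyc j) 0 = cyc j from Subtype.ext (arcPt_zero _)] at this

/-- Every vertex of the first stage has two neighbours there. -/
lemma exists_two_nbrs (c : tagLE p 1) : ∃ x y : tagLE p 1, x ≠ y ∧
    (polyGraph p).Adj c.1 x.1 ∧ (polyGraph p).Adj c.1 y.1 := by
  obtain ⟨c, hc⟩ := c
  change c.1.tag ≤ 1 at hc
  rcases Nat.eq_zero_or_pos c.1.tag with h0 | h0
  · obtain ⟨j, rfl⟩ := eq_cyc_of_tag h0
    obtain ⟨x, y, z, h1, -, -, h2, h3, -⟩ := exists_three_nbrs j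
    exact ⟨x, y, h1, h2, h3⟩
  · obtain ⟨i, -, t, ht0, ht1, rfl⟩ := exists_arc_of_tag_eq_one (v := c) (by omega)
    have hJ := joins_cyc (i : ZMod p.N)
    refine ⟨⟨arcPt hJ (t - 1), arcPt_mem_tagLE hJ _⟩,
      ⟨arcPt hJ (t + 1), arcPt_mem_tagLE hJ _⟩, fun e => ?_, ?_, arcPt_adj hJ ht1⟩
    · have := arcPt_inj hJ (by omega) (by omega) (congrArg Subtype.val e)
      omega
    · have := arcPt_adj (joins_cyc (i : ZMod p.N)) (t := t - 1) (by omega)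
      rw [Nat.sub_add_cancel ht0] at this
      exact this.symm

/-- The three neighbours of a cycle vertex in stage 1 have distinct images, so its image cannot be
an inner vertex of a clean arc. -/
lemma IsEmb.not_valencyIn_cyc {g : tagLE p 1 → Poly p} (hg : IsEmb g) {S : Set (Poly p)}
    (hS : Set.range g ⊆ S) {c : tagLE p 1} (hc : c.1.1.tag = 0) :
    valencyIn (polyGraph p) S (g c) ≠ 2 := by
  intro h
  obtain ⟨j, hj⟩ := eq_cyc_of_tag hc
  obtain ⟨x, y, z, h1, h2, h3, hx, hy, hz⟩ := exists_three_nbrs j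
  rw [← hj] at hx hy hz
  rcases eq_or_eq_of_valencyIn_eq_two h (fun e => h1 (hg.inj _ _ e)) (hS ⟨x, rfl⟩) (hg.adj _ _ hx)
    (hS ⟨y, rfl⟩) (hg.adj _ _ hy) (hS ⟨z, rfl⟩) (hg.adj _ _ hz) with e | e
  · exact h2 (hg.inj _ _ e)
  · exact h3 (hg.inj _ _ e)

/-- Every embedding of the first stage that fixes the midpoints maps it to itself. -/
theorem IsEmb.range_subset {g : tagLE p 1 → Poly p} (hg : IsEmb g) (c : tagLE p 1) :
    g c ∈ tagLE p 1 := by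
  by_contra hcon
  set B := Set.range g \ tagLE p 1
  have hfin : B.Finite := (Set.finite_range g).subset Set.sdiff_subset
  have hS : Set.range g ⊆ tagLE p 1 ∪ B := fun v hv => by
    by_cases h : v ∈ tagLE p 1
    · exact Or.inl h
    · exact Or.inr ⟨hv, h⟩
  -- It suffices that `B`, the part of the image outside stage 1, is closed over stage 1.
  refine isStrong_tagLE_one B hfin ⟨g c, ⟨c, rfl⟩, hcon⟩ ⟨Set.disjoint_sdiff_right, ?_, ?_⟩
  · rintro _ ⟨⟨c, rfl⟩, -⟩ ⟨-, hle⟩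
    obtain ⟨x, y, hxy, hx, hy⟩ := exists_two_nbrs c
    rw [valencyIn, Set.encard_le_one_iff] at hle
    exact hxy (hg.inj _ _ (hle _ _ ⟨hg.adj _ _ hx, hS ⟨x, rfl⟩⟩ ⟨hg.adj _ _ hy, hS ⟨y, rfl⟩⟩))
  · rintro x y w ⟨hpath, hlen, hsupp, hval⟩ hB
    have h3 := p.three_le
    have hl : len p 0 = 2 * p.h := rfl
    obtain ⟨⟨c, hc⟩, hcB⟩ := hB 1 le_rfl (by omega)
    have hc1 : c.1.1.tag = 1 := by
      have h1 : c.1.1.tag ≤ 1 := c.2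
      have h2 : c.1.1.tag ≠ 0 := fun h0 => hg.not_valencyIn_cyc hS h0 (by
        rw [hc]; exact hval 1 le_rfl (by omega))
      omega
    have hmid : ∀ j : ZMod p.N, g ⟨arcPt (joins_cyc j) p.h, arcPt_mem_tagLE _ _⟩ ∉ B := by
      rintro j ⟨-, h⟩
      rw [hg.fix _ ⟨j, rfl⟩] at h
      exact h (arcPt_mem_tagLE (joins_cyc j) _)
    -- Midpoints are fixed, hence not in `B`. After possibly reversing the arc, `c` lies strictly
    -- between its start and its midpoint.
    obtain ⟨j, t, ht0, ht1, e⟩ : ∃ j : ZMod p.N, ∃ t, 0 < t ∧ t < p.h ∧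
        c.1 = arcPt (joins_cyc j) t := by
      obtain ⟨i, -, t, ht0, ht1, e⟩ := exists_arc_of_tag_eq_one hc1
      rcases lt_trichotomy t p.h with h | rfl | h
      · exact ⟨i, t, ht0, h, e⟩
      · refine absurd ?_ (hmid (i : ZMod p.N))
        rw [show (⟨arcPt (joins_cyc (i : ZMod p.N)) p.h, arcPt_mem_tagLE _ _⟩ : tagLE p 1) = c from
          Subtype.ext e.symm, hc]
        exact hB 1 le_rfl (by omega)
      · refine ⟨(i : ZMod p.N) + p.k, len p 0 - t, by omega, by omega, ?_⟩
        rw [e]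
        refine Subtype.ext ?_
        rw [arcPt_val, arcPt_val, pt_symm (joins_ne (joins_cyc _)) ht1.le, add_assoc, p.k_add_k,
          add_zero]
    -- Valency two forces the clean arc to follow the image of the arc at `j`. It can leave the open
    -- half neither through the cycle vertex, whose image has too many neighbours, nor through the
    -- midpoint, which is not in `B`.
    have hq : ∀ s, 1 ≤ s → s + 2 ≤ p.n → ∃ t, 0 < t ∧ t < p.h ∧
        w.getVert s = g ⟨arcPt (joins_cyc j) t, arcPt_mem_tagLE _ _⟩ := by
      intro s hs
      induction s, hs using Nat.le_induction with
      | base =>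
        intro _
        exact ⟨t, ht0, ht1, hc.symm.trans (congrArg g (Subtype.ext e))⟩
      | succ s hs ih =>
        intro hs2
        obtain ⟨t, ht0, ht1, e⟩ := ih (by omega)
        have hB' := hB (s + 1) (by omega) hs2
        have hv := hval s hs (by omega)
        have ha := w.adj_getVert_succ (i := s) (by omega)
        rw [e] at hv ha
        have hl1 := arcPt_adj (joins_cyc j) (t := t - 1) (by omega)
        rw [Nat.sub_add_cancel ht0] at hl1
        rcases eq_or_eq_of_valencyIn_eq_two hv
          (x := g ⟨arcPt (joins_cyc j) (t - 1), arcPt_mem_tagLE _ _⟩)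
          (y := g ⟨arcPt (joins_cyc j) (t + 1), arcPt_mem_tagLE _ _⟩)
          (fun e => by
            have := arcPt_inj (joins_cyc j) (by omega) (by omega)
              (congrArg Subtype.val (hg.inj _ _ e))
            omega)
          (hS ⟨_, rfl⟩) (hg.adj _ _ hl1.symm) (hS ⟨_, rfl⟩)
          (hg.adj _ _ (arcPt_adj (joins_cyc j) (by omega))) (Or.inr hB') ha with e1 | e1
        · have : t - 1 ≠ 0 := by
            intro h0
            have hv' := hval (s + 1) (by omega) hs2
            rw [e1] at hv'
            refine hg.not_valencyIn_cyc hS ?_ hv'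
            change (arcPt (joins_cyc j) (t - 1)).1.tag = 0
            rw [h0, arcPt_zero]; rfl
          exact ⟨t - 1, by omega, by omega, e1⟩
        · have : t + 1 ≠ p.h := by
            intro h0
            rw [e1] at hB'
            simp only [h0] at hB'
            exact hmid j hB'
          exact ⟨t + 1, by omega, by omega, e1⟩
    choose! f hf0 hf1 hf2 using hq
    -- The clean arc has `n - 2` inner vertices and the open half arc only `h - 1`, which
    -- contradicts `2h ≤ n` and `3 ≤ n`.
    have hcard := Finset.card_le_card_of_injOn (s := Finset.Icc 1 (p.n - 2))
      (t := Finset.Ioo 0 p.h) f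
      (fun s hs => by
        have := Finset.mem_Icc.1 (Finset.mem_coe.1 hs)
        exact Finset.mem_coe.2 (Finset.mem_Ioo.2 ⟨hf0 s (by omega) (by omega),
          hf1 s (by omega) (by omega)⟩))
      (fun s hs s' hs' e => by
        have h1 := Finset.mem_Icc.1 (Finset.mem_coe.1 hs)
        have h2 := Finset.mem_Icc.1 (Finset.mem_coe.1 hs')
        refine hpath.getVert_injOn (by change s ≤ _; omega) (by change s' ≤ _; omega) ?_
        rw [hf2 s (by omega) (by omega), hf2 s' (by omega) (by omega)]
        simp only [e])
    rw [Nat.card_Icc, Nat.card_Ioo] at hcard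
    have := p.le_n
    omega

end OpenPolygon

namespace OpenPolygon

/-! ### Algebraic closure -/

section

variable {V : Type*} {G : SimpleGraph V} {P : Set V}

/-- The symbol for adjacency. -/
def adjRel : bipLanguage.Relations 2 := BipRel.adj

lemma definable_adj {α : Type*} (A : Set V) (c d : α) :
    letI := bipStructure G P
    A.Definable bipLanguage {g : α → V | G.Adj (g c) (g d)} := by
  let := bipStructure G P
  refine Set.Definable.mono (A := ∅) (Set.empty_definable_iff.2
    ⟨Language.Relations.formula₂ (L := bipLanguage) adjRel
      (Language.Term.var c) (Language.Term.var d), ?_⟩) (Set.empty_subset _)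
  ext g
  exact (Language.Formula.realize_rel₂ (R := adjRel) (v := g)
    (t₁ := Language.Term.var c) (t₂ := Language.Term.var d)).symm

lemma definable_eq {α : Type*} (A : Set V) (c d : α) :
    letI := bipStructure G P
    A.Definable bipLanguage {g : α → V | g c = g d} := by
  let := bipStructure G P
  refine ⟨(Language.Term.var c).equal (Language.Term.var d), ?_⟩
  ext g
  change _ ↔ Language.Formula.Realize _ g
  rw [Language.Formula.realize_equal]
  rfl

lemma definable_eq_const {α : Type*} {A : Set V} (c : α) {a : V} (ha : a ∈ A) :
    letI := bipStructure G P
    A.Definable bipLanguage {g : α → V | g c = a} := by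
  let := bipStructure G P
  have h : A.Definable bipLanguage {x : Fin 1 → V | x 0 ∈ ({a} : Set V)} :=
    Set.Definable.singleton_of_mem bipLanguage ha
  exact h.preimage_comp (fun _ : Fin 1 => c)

lemma definable_imp {α : Type*} {A : Set V} (Q : Prop) {s : Set (α → V)}
    (h : letI := bipStructure G P; A.Definable bipLanguage s) :
    letI := bipStructure G P
    A.Definable bipLanguage {g : α → V | Q → g ∈ s} := by
  let := bipStructure G P
  by_cases hQ : Q
  · simpa [hQ] using h
  · simp only [hQ, false_imp_iff]
    exact Set.definable_univ

end

variable {p : CycleParams}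

/-- Stage 1 is finite, so being an embedding is a finite conjunction of atomic conditions and their
negations. -/
lemma definable_isEmb : letI := bipStructure (polyGraph p) (polyPoints p)
    (mids p).Definable bipLanguage {g | IsEmb (p := p) g} := by
  let := bipStructure (polyGraph p) (polyPoints p)
  have e : {g | IsEmb (p := p) g} =
      (⋂ c, ⋂ d, {g : tagLE p 1 → Poly p | ¬ c = d → g ∈ {g | g c = g d}ᶜ}) ∩
      ((⋂ c : tagLE p 1, ⋂ d : tagLE p 1, {g : tagLE p 1 → Poly p |
        (polyGraph p).Adj c.1 d.1 → g ∈ {g | (polyGraph p).Adj (g c) (g d)}}) ∩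
      ⋂ c : tagLE p 1, {g : tagLE p 1 → Poly p | c.1 ∈ mids p → g ∈ {g | g c = c.1}}) := by
    ext g
    simp only [Set.mem_inter_iff, Set.mem_iInter]
    constructor
    · intro h
      exact ⟨fun c d hcd e => hcd (h.inj c d e), h.adj, h.fix⟩
    · rintro ⟨h1, h2, h3⟩
      exact ⟨fun c d e => by_contra fun hcd => h1 c d hcd e, h2, h3⟩
  rw [e]
  refine Set.Definable.inter ?_ (Set.Definable.inter ?_ ?_)
  · exact Set.definable_iInter_of_finite fun c => Set.definable_iInter_of_finite fun d =>
      definable_imp _ (definable_eq (mids p) c d).compl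
  · exact Set.definable_iInter_of_finite fun c => Set.definable_iInter_of_finite fun d =>
      definable_imp _ (definable_adj (mids p) c d)
  · refine Set.definable_iInter_of_finite fun c => ?_
    by_cases hc : c.1 ∈ mids p
    · exact definable_imp _ (definable_eq_const c hc)
    · have : {g : tagLE p 1 → Poly p | c.1 ∈ mids p → g ∈ {g | g c = c.1}} = Set.univ :=
        Set.eq_univ_of_forall fun g h => absurd h hc
      rw [this]
      exact Set.definable_univ

/-- All vertices of the first stage are algebraic over the midpoints. -/
theorem mem_acl {v : Poly p} (hv : v ∈ tagLE p 1) :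
    letI := bipStructure (polyGraph p) (polyPoints p)
    v ∈ bipLanguage.acl (mids p) := by
  let := bipStructure (polyGraph p) (polyPoints p)
  -- The witness is the set of all images of `v`. It is a projection of the definable set of
  -- embeddings, it lies in the finite stage 1, and the inclusion puts `v` into it.
  refine ⟨{a | ∃ g, IsEmb (p := p) g ∧ g ⟨v, hv⟩ = a}, ?_, finite_tagLE_one.subset ?_,
    fun c => c.1, ⟨fun c d e => Subtype.ext e, fun _ _ h => h, fun _ _ => rfl⟩, rfl⟩
  · have h := (definable_isEmb (p := p)).image_comp (fun _ : Fin 1 => (⟨v, hv⟩ : tagLE p 1))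
    unfold Set.Definable₁
    convert h using 1
    ext x
    constructor
    · rintro ⟨g, hg, e⟩
      refine ⟨g, hg, funext fun i => ?_⟩
      rw [Subsingleton.elim i 0]
      exact e
    · rintro ⟨g, hg, rfl⟩
      exact ⟨g, hg, rfl⟩
  · rintro _ ⟨g, hg, rfl⟩
    exact hg.range_subset _

/-! ### The antipodal automorphism -/

/-- The antipodal map of the cycle, extended to all vertices. -/
noncomputable def antipode : Vtx p.N → Vtx p.N
  | .base j => .base (j + p.k)
  | .arc i a b t => mk p i (antipode a) (antipode b) t
  | .iso i c => .iso i c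

/-- The antipodal map need not respect the well-ordering that orients the arcs. The hypothesis
provides distinct ends, so that `mk_symm` can correct the orientation. -/
lemma antipode_pt {i : ℕ} {a b : Vtx p.N} (h' : Joins p i (antipode a) (antipode b))
    (t : ℕ) : antipode (pt p i a b t) = pt p i (antipode a) (antipode b) t := by
  unfold pt
  split_ifs with h0 h1
  · rfl
  · by_cases hw : WellOrderingRel a b
    · rw [mk, if_pos hw]; rfl
    · rw [mk, if_neg hw, mk_symm (joins_ne h') h1.le]; rfl
  · rfl

/-- The antipodal map is an automorphism of a stage. -/
structure AntipodeAut (p : CycleParams) (i : ℕ) : Prop where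
  mem : ∀ v ∈ SV p i, antipode v ∈ SV p i
  antipode_antipode : ∀ v ∈ SV p i, antipode (antipode v) = v
  color : ∀ v ∈ SV p i, (antipode v).color = v.color
  adj : ∀ u v, (SG p i).Adj u v → (SG p i).Adj (antipode u) (antipode v)

/-- As the map is an involution, a walk between the images is carried back to a walk of the same
length between the original vertices. -/
lemma AntipodeAut.joins {i : ℕ} (h : AntipodeAut p i) {a b : Vtx p.N} (hJ : Joins p i a b) :
    Joins p i (antipode a) (antipode b) := by
  have ha := joins_mem hJ
  have hb := joins_mem (joins_symm hJ)
  rcases Nat.eq_zero_or_pos i with rfl | hi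
  · obtain ⟨j, rfl, rfl⟩ := joins_zero.1 hJ
    exact joins_zero.2 ⟨j + p.k, rfl, rfl⟩
  · obtain ⟨-, -, h3, h4⟩ := (joins_of_pos hi).1 hJ
    refine (joins_of_pos hi).2 ⟨h.mem a ha, h.mem b hb, by rw [h.color a ha, h.color b hb, h3],
      fun w => ?_⟩
    let φ : SG p i →g SG p i := ⟨antipode, fun {u v} huv => h.adj u v huv⟩
    have := h4 ((w.map φ).copy (h.antipode_antipode a ha) (h.antipode_antipode b hb))
    rwa [SimpleGraph.Walk.length_copy, SimpleGraph.Walk.length_map] at this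

lemma antipodeAut (i : ℕ) : AntipodeAut p i := by
  induction i with
  | zero =>
    refine ⟨fun v hv => ?_, fun v hv => ?_, fun v hv => ?_, fun u v h => ?_⟩
    · obtain ⟨j, rfl⟩ := mem_SV_zero.1 hv
      exact mem_SV_zero.2 ⟨_, rfl⟩
    · obtain ⟨j, rfl⟩ := mem_SV_zero.1 hv
      simp only [antipode, add_assoc, p.k_add_k, add_zero]
    · obtain ⟨j, rfl⟩ := mem_SV_zero.1 hv
      exact color_base_add_k j
    · obtain ⟨j, rfl, rfl | rfl⟩ := adj_zero.1 h
      · exact adj_zero.2 ⟨_, rfl, Or.inl (by simp only [antipode]; congr 1; ring)⟩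
      · exact adj_zero.2 ⟨_, rfl, Or.inr (by simp only [antipode]; congr 1; ring)⟩
  | succ i ih =>
    refine ⟨fun v hv => ?_, fun v hv => ?_, fun v hv => ?_, fun u v h => ?_⟩
    · rcases mem_SV_succ.1 hv with h | ⟨a, b, t, hJ, h0, h1, rfl⟩ | ⟨h, c, rfl⟩
      · exact SV_le_succ i (ih.mem v h)
      · rw [antipode_pt (ih.joins hJ)]
        exact pt_mem (ih.joins hJ) t
      · exact hv
    · rcases mem_SV_succ.1 hv with h | ⟨a, b, t, hJ, h0, h1, rfl⟩ | ⟨h, c, rfl⟩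
      · exact ih.antipode_antipode v h
      · rw [antipode_pt (ih.joins hJ), antipode_pt (ih.joins (ih.joins hJ)),
          ih.antipode_antipode a (joins_mem hJ), ih.antipode_antipode b (joins_mem (joins_symm hJ))]
      · rfl
    · rcases mem_SV_succ.1 hv with h | ⟨a, b, t, hJ, h0, h1, rfl⟩ | ⟨h, c, rfl⟩
      · exact ih.color v h
      · rw [antipode_pt (ih.joins hJ), color_pt (joins_color hJ) h1.le,
          color_pt (joins_color (ih.joins hJ)) h1.le, ih.color a (joins_mem hJ)]
      · rfl
    · rcases adj_succ.1 h with h | ⟨a, b, t, hJ, ht, rfl, rfl⟩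
      · exact adj_succ.2 (Or.inl (ih.adj u v h))
      · rw [antipode_pt (ih.joins hJ), antipode_pt (ih.joins hJ)]
        exact adj_pt (ih.joins hJ) ht

/-- The antipodal map on the polygon. -/
noncomputable def polyAntipode : Poly p ≃ Poly p where
  toFun v := ⟨antipode v.1, v.2.choose, (antipodeAut _).mem _ v.2.choose_spec⟩
  invFun v := ⟨antipode v.1, v.2.choose, (antipodeAut _).mem _ v.2.choose_spec⟩
  left_inv v := Subtype.ext ((antipodeAut _).antipode_antipode _ v.2.choose_spec)
  right_inv v := Subtype.ext ((antipodeAut _).antipode_antipode _ v.2.choose_spec)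

lemma polyAntipode_polyAntipode (v : Poly p) : polyAntipode (polyAntipode v) = v :=
  polyAntipode.left_inv v

lemma polyAntipode_adj {u v : Poly p} (h : (polyGraph p).Adj u v) :
    (polyGraph p).Adj (polyAntipode u) (polyAntipode v) := by
  obtain ⟨i, h⟩ := h
  exact ⟨i, (antipodeAut i).adj _ _ h⟩

lemma polyAntipode_color (v : Poly p) : (polyAntipode v).1.color = v.1.color :=
  (antipodeAut _).color _ v.2.choose_spec

lemma polyAntipode_cyc (j : ZMod p.N) : polyAntipode (cyc j) = cyc (j + (p.k : ZMod p.N)) := rfl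

/-- The arc from `j` to `j + k` is mapped to itself reversed, and position `h` of `2h` is invariant
under reversal. -/
lemma polyAntipode_mids {v : Poly p} (hv : v ∈ mids p) : polyAntipode v = v := by
  obtain ⟨j, rfl⟩ := hv
  have hJ := joins_cyc (p := p) j
  have hl : len p 0 = 2 * p.h := rfl
  refine Subtype.ext ?_
  change antipode (pt p 0 _ _ _) = pt p 0 _ _ _
  rw [antipode_pt ((antipodeAut 0).joins hJ)]
  simp only [antipode]
  rw [pt_symm (joins_ne (joins_cyc _)) (by omega), add_assoc, p.k_add_k, add_zero]
  congr 1
  omega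

/-- The antipodal map as an automorphism of the structure. -/
noncomputable def polyAut : letI := bipStructure (polyGraph p) (polyPoints p)
    Poly p ≃[bipLanguage] Poly p :=
  letI := bipStructure (polyGraph p) (polyPoints p)
  { polyAntipode with
    map_fun' := fun f => nomatch f
    map_rel' := by
      intro n r x
      cases r with
      | adj =>
        refine ⟨fun h => ?_, polyAntipode_adj⟩
        have := polyAntipode_adj (u := polyAntipode (x 0)) (v := polyAntipode (x 1)) h
        rwa [polyAntipode_polyAntipode, polyAntipode_polyAntipode] at this
      | point =>
        change (polyAntipode (x 0)).1.color = 0 ↔ (x 0).1.color = 0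
        rw [polyAntipode_color]
      | line =>
        change ¬ (polyAntipode (x 0)).1.color = 0 ↔ ¬ (x 0).1.color = 0
        rw [polyAntipode_color] }

/-- Automorphisms over `A` fix the definable closure of `A`. -/
lemma eq_of_mem_dcl {L : Language} {M : Type*} [L.Structure M] {A : Set M} {a : M}
    (ha : a ∈ L.dcl A) (σ : M ≃[L] M) (hσ : ∀ b ∈ A, σ b = b) : σ a = a := by
  obtain ⟨φ, hφ⟩ := Set.definable_iff_exists_formula_sum.1 ha
  have h1 : (fun _ : Fin 1 => a) ∈ {x : Fin 1 → M | x 0 ∈ ({a} : Set M)} := rfl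
  have h2 : (fun _ : Fin 1 => σ a) ∈ {x : Fin 1 → M | x 0 ∈ ({a} : Set M)} := by
    rw [hφ] at h1 ⊢
    change φ.Realize _ at h1
    change φ.Realize _
    rw [← Language.StrongHomClass.realize_formula σ] at h1
    convert h1 using 1
    funext x
    rcases x with x | x
    · exact (hσ x.1 x.2).symm
    · rfl
  exact h2

theorem cyc_notMem_dcl (j : ZMod p.N) :
    letI := bipStructure (polyGraph p) (polyPoints p)
    cyc j ∉ bipLanguage.dcl (mids p) := by
  let := bipStructure (polyGraph p) (polyPoints p)
  intro h
  have h1 : polyAntipode (cyc j) = cyc j := eq_of_mem_dcl h polyAut fun b hb => polyAntipode_mids hb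
  rw [polyAntipode_cyc] at h1
  have := cyc_injective h1
  exact p.k_ne_zero (by simpa using this)

end OpenPolygon

namespace OpenPolygon

/-! ### The configurations -/

variable {p : CycleParams}

/-- The indices `j` and `j + k` name the same arc in opposite directions, so half of the indices
give all midpoints. -/
lemma range_mids : Set.range (fun i : Fin p.k => arcPt (joins_cyc ((i : ℕ) : ZMod p.N)) p.h) =
    mids p := by
  ext v
  constructor
  · rintro ⟨i, rfl⟩
    exact ⟨_, rfl⟩
  · rintro ⟨j, rfl⟩
    obtain ⟨i, hi, rfl | rfl⟩ := exists_natCast_lt_k j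
    · exact ⟨⟨i, hi⟩, rfl⟩
    · have hl : len p 0 = 2 * p.h := rfl
      refine ⟨⟨i, hi⟩, Subtype.ext ?_⟩
      simp only [arcPt_val]
      rw [pt_symm (joins_ne (joins_cyc _)) (by omega), add_assoc, p.k_add_k, add_zero]
      congr 1
      omega

lemma exists_arc_walk {a b : Vtx p.N} (h : Joins p 0 a b) (s m : ℕ) (hs : s + m ≤ len p 0)
    {x y : Poly p} (hx : arcPt h s = x) (hy : arcPt h (s + m) = y) :
    ∃ w : (polyGraph p).Walk x y, w.length = m ∧ ∀ t ≤ m, w.getVert t = arcPt h (s + t) := by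
  subst hx hy
  exact exists_walk (fun t => arcPt h (s + t)) m fun t ht => arcPt_adj h (by omega)

lemma arcPt_zero_eq_cyc (j : ZMod p.N) : arcPt (joins_cyc j) 0 = cyc j :=
  Subtype.ext (arcPt_zero _)

lemma arcPt_len_eq_cyc (j : ZMod p.N) {t : ℕ} (ht : len p 0 ≤ t) :
    arcPt (joins_cyc j) t = cyc (j + (p.k : ZMod p.N)) :=
  Subtype.ext (arcPt_len _ ht)

/-- Paths along the arcs of the first stage give clean arcs in every set of vertices of the first
stage that contains them. -/
lemma isCleanArc_of_getVert {j : ZMod p.N} {s : ℕ} (hs : s + p.n = len p 0 + 1)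
    {S : Set (Poly p)} (hS : S ⊆ tagLE p 1) {x y : Poly p} (w : (polyGraph p).Walk x y)
    (hw : w.length = p.n - 1)
    (hg : ∀ t ≤ p.n - 1, w.getVert t = arcPt (joins_cyc j) (s + t))
    (hwS : ∀ v ∈ w.support, v ∈ S) : IsCleanArc p.n (polyGraph p) S w := by
  have h3 := p.three_le
  have harc := (joins_cyc (p := p) j).isArc
  have harc' : IsArc (polyGraph p) (tagLE p 1) (fun t => arcPt (joins_cyc j) (s + t))
      (p.n - 1) := by
    refine ⟨fun t ht t' ht' e => ?_, fun t ht => harc.adj (s + t) (by omega),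
      fun t h0 h1 v hv ha => ?_⟩
    · have := harc.inj _ (by omega) _ (by omega) e
      omega
    · have := harc.nbr (s + t) (by omega) (by omega) v hv ha
      rwa [show s + t - 1 = s + (t - 1) by omega] at this
  refine harc'.isCleanArc hS (by omega) w (by omega) (fun t ht => hg t (by omega)) fun t ht => ?_
  have := hwS _ (w.getVert_mem_support t)
  rwa [hg t (by omega)] at this

lemma support_subset {j : ZMod p.N} {s m : ℕ} {x y : Poly p} {w : (polyGraph p).Walk x y}
    (hw : w.length = m) (hg : ∀ t ≤ m, w.getVert t = arcPt (joins_cyc j) (s + t)) :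
    {v | v ∈ w.support} ⊆ tagLE p 1 := by
  intro v hv
  obtain ⟨t, rfl, ht⟩ := SimpleGraph.Walk.mem_support_iff_exists_getVert.1 hv
  rw [hg t (by omega)]
  exact arcPt_mem_tagLE _ _

/-- The case of odd `n`: the path `γ i` is the whole antipodal arc. -/
lemma exists_paths_of_len_add_one (hlen : len p 0 + 1 = p.n) :
    ∃ γ : ∀ i : Fin p.k, (polyGraph p).Walk (cyc ((i : ℕ) : ZMod p.N))
        (cyc ((i + p.k : ℕ) : ZMod p.N)),
      ∀ i, IsCleanArc p.n (polyGraph p) (Set.range cyc ∪ ⋃ k, {v | v ∈ (γ k).support}) (γ i) ∧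
        arcPt (joins_cyc ((i : ℕ) : ZMod p.N)) p.h = (γ i).getVert p.h := by
  have h3 := p.three_le
  have hle := p.le_n
  have hl : len p 0 = 2 * p.h := rfl
  choose γ hγ hg using fun i : Fin p.k =>
    exists_arc_walk (joins_cyc ((i : ℕ) : ZMod p.N)) 0 (p.n - 1) (by omega)
      (arcPt_zero_eq_cyc _) (y := cyc ((i + p.k : ℕ) : ZMod p.N))
      (by rw [arcPt_len_eq_cyc _ (by omega)]; push_cast; rfl)
  refine ⟨γ, fun i => ⟨isCleanArc_of_getVert (by omega) ?_ (γ i) (hγ i) (hg i) ?_, ?_⟩⟩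
  · exact Set.union_subset range_cyc_subset
      (Set.iUnion_subset fun k => support_subset (hγ k) (hg k))
  · exact fun v hv => Or.inr (Set.mem_iUnion.2 ⟨i, hv⟩)
  · rw [hg i _ (by omega), zero_add]

/-- The case of even `n`: the path `γ i` is the antipodal arc without its first edge, so position
`h` on the arc becomes position `h - 1 = (n - 2) / 2`. -/
lemma exists_paths_of_len_eq (hlen : len p 0 = p.n) :
    ∃ γ : ∀ i : Fin p.k, (polyGraph p).Walk (arcPt (joins_cyc ((i : ℕ) : ZMod p.N)) 1)
        (cyc ((i + p.k : ℕ) : ZMod p.N)),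
      ∀ i, IsCleanArc p.n (polyGraph p) (Set.range cyc ∪
          Set.range (fun i : Fin p.k => arcPt (joins_cyc ((i : ℕ) : ZMod p.N)) 1) ∪
          ⋃ k, {v | v ∈ (γ k).support}) (γ i) ∧
        arcPt (joins_cyc ((i : ℕ) : ZMod p.N)) p.h = (γ i).getVert ((p.n - 2) / 2) := by
  have h3 := p.three_le
  have hl : len p 0 = 2 * p.h := rfl
  choose γ hγ hg using fun i : Fin p.k =>
    exists_arc_walk (joins_cyc ((i : ℕ) : ZMod p.N)) 1 (p.n - 1) (by omega)
      rfl (y := cyc ((i + p.k : ℕ) : ZMod p.N))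
      (by rw [arcPt_len_eq_cyc _ (by omega)]; push_cast; rfl)
  refine ⟨γ, fun i => ⟨isCleanArc_of_getVert (by omega) ?_ (γ i) (hγ i) (hg i) ?_, ?_⟩⟩
  · refine Set.union_subset (Set.union_subset range_cyc_subset ?_)
      (Set.iUnion_subset fun k => support_subset (hγ k) (hg k))
    rintro _ ⟨i, rfl⟩
    exact arcPt_mem_tagLE _ _
  · exact fun v hv => Or.inr (Set.mem_iUnion.2 ⟨i, hv⟩)
  · rw [hg i _ (by omega)]
    congr 1
    omega

lemma isOrderedCycle_cyc : IsOrderedCycle (polyGraph p) (cyc (p := p)) :=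
  ⟨cyc_injective, cyc_adj⟩

lemma arcPt_one_ne_cyc (i j : ZMod p.N) : arcPt (joins_cyc i) 1 ≠ cyc j := by
  intro e
  have hl := two_le_len p 0
  have := arcPt_tag (joins_cyc i) (t := 1) (by omega) (by omega)
  rw [e, tag_cyc] at this
  omega

lemma cyc_adj_arcPt_one (j : ZMod p.N) : (polyGraph p).Adj (cyc j) (arcPt (joins_cyc j) 1) := by
  have hl := two_le_len p 0
  have := arcPt_adj (joins_cyc j) (t := 0) (by omega)
  rwa [arcPt_zero_eq_cyc] at this

lemma cyc_mem_acl (j : ZMod p.N) : letI := bipStructure (polyGraph p) (polyPoints p)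
    cyc j ∈ bipLanguage.acl (mids p) :=
  mem_acl (range_cyc_subset ⟨j, rfl⟩)

lemma acl_ne_dcl : letI := bipStructure (polyGraph p) (polyPoints p)
    ∃ A : Set (Poly p), A.Finite ∧ bipLanguage.acl A ≠ bipLanguage.dcl A :=
  ⟨mids p, finite_tagLE_one.subset mids_subset, fun e =>
    cyc_notMem_dcl (p := p) 0 (e ▸ cyc_mem_acl 0)⟩

lemma models_theory : letI := bipStructure (polyGraph p) (polyPoints p)
    Poly p ⊨ openPolygonTheory p.n :=
  letI := bipStructure (polyGraph p) (polyPoints p)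
  ⟨fun _ hφ => hφ (Poly p) (polyGraph p) (polyPoints p) isOpenPolygon⟩

/-- The parameters for odd `n`. -/
abbrev oddParams (n : ℕ) (hn : 3 ≤ n) (ho : Odd n) : CycleParams where
  n := n
  N := 2 * n + 2
  k := n + 1
  h := (n - 1) / 2
  three_le := hn
  N_eq := by ring
  even_k := ho.add_one
  sum_eq := by obtain ⟨r, rfl⟩ := ho; omega
  n_le := by obtain ⟨r, rfl⟩ := ho; omega
  le_n := by omega

/-- The parameters for even `n`. -/
abbrev evenParams (n : ℕ) (hn : 3 ≤ n) (he : Even n) : CycleParams where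
  n := n
  N := 2 * n
  k := n
  h := n / 2
  three_le := hn
  N_eq := rfl
  even_k := he
  sum_eq := by obtain ⟨r, rfl⟩ := he; omega
  n_le := by omega
  le_n := by omega

lemma isOddConfiguration (n : ℕ) (hn : 3 ≤ n) (ho : Odd n) :
    IsOddConfiguration n (polyGraph (oddParams n hn ho)) (cyc (p := oddParams n hn ho))
      fun i => arcPt (joins_cyc ((i : ℕ) : ZMod (oddParams n hn ho).N)) (oddParams n hn ho).h := by
  obtain ⟨γ, hγ⟩ := exists_paths_of_len_add_one (p := oddParams n hn ho) (by
    change 2 * ((n - 1) / 2) + 1 = n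
    obtain ⟨r, rfl⟩ := ho; omega)
  exact ⟨isOrderedCycle_cyc, isStrong_cyc (p := oddParams n hn ho), γ, hγ⟩

lemma isEvenConfiguration (n : ℕ) (hn : 3 ≤ n) (he : Even n) :
    IsEvenConfiguration n (polyGraph (evenParams n hn he)) (cyc (p := evenParams n hn he))
      (fun i => arcPt (joins_cyc ((i : ℕ) : ZMod (evenParams n hn he).N)) 1)
      fun i => arcPt (joins_cyc ((i : ℕ) : ZMod (evenParams n hn he).N))
        (evenParams n hn he).h := by
  have hlen : len (evenParams n hn he) 0 = (evenParams n hn he).n := by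
    change 2 * (n / 2) = n
    obtain ⟨r, rfl⟩ := he; omega
  obtain ⟨γ, hγ⟩ := exists_paths_of_len_eq hlen
  refine ⟨isOrderedCycle_cyc, fun i => ⟨cyc_adj_arcPt_one (p := evenParams n hn he) _,
    arcPt_one_ne_cyc (p := evenParams n hn he) _ _, arcPt_one_ne_cyc (p := evenParams n hn he) _ _⟩,
    ?_, γ, hγ⟩
  convert isStrong_cyc_union hlen.ge using 2
  ext v
  constructor
  · rintro ⟨i, rfl⟩
    exact ⟨i, i.2, rfl⟩
  · rintro ⟨i, hi, rfl⟩
    exact ⟨⟨i, hi⟩, rfl⟩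

end OpenPolygon

/-- Algebraic and definable closure differ in the theory of open generalized `n`-gons; moreover
explicit cycles are algebraic, but no vertex of them is definable, over the midpoints of arcs. -/
theorem mainTheorem7 (n : ℕ) (hn : 3 ≤ n) :
    ∃ (V : Type) (G : SimpleGraph V) (P : Set V),
      letI : OpenPolygon.bipLanguage.Structure V := OpenPolygon.bipStructure G P
      OpenPolygon.IsOpenPolygon n G P ∧
      V ⊨ OpenPolygon.openPolygonTheory n ∧
      (∃ A : Set V, A.Finite ∧ OpenPolygon.bipLanguage.acl A ≠ OpenPolygon.bipLanguage.dcl A) ∧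
      (Odd n → ∃ (x : ZMod (2 * n + 2) → V) (m : Fin (n + 1) → V),
        OpenPolygon.IsOddConfiguration n G x m ∧
        ∀ i, x i ∈ OpenPolygon.bipLanguage.acl (Set.range m) ∧
          x i ∉ OpenPolygon.bipLanguage.dcl (Set.range m)) ∧
      (Even n → ∃ (x : ZMod (2 * n) → V) (y m : Fin n → V),
        OpenPolygon.IsEvenConfiguration n G x y m ∧
        ∀ i, x i ∈ OpenPolygon.bipLanguage.acl (Set.range m) ∧
          x i ∉ OpenPolygon.bipLanguage.dcl (Set.range m)) := by
  rcases Nat.even_or_odd n with he | ho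
  · refine ⟨OpenPolygon.Poly (OpenPolygon.evenParams n hn he), OpenPolygon.polyGraph _,
      OpenPolygon.polyPoints _, OpenPolygon.isOpenPolygon (p := OpenPolygon.evenParams n hn he),
      OpenPolygon.models_theory (p := OpenPolygon.evenParams n hn he),
      OpenPolygon.acl_ne_dcl (p := OpenPolygon.evenParams n hn he),
      fun ho => absurd he (Nat.not_even_iff_odd.2 ho), fun _ =>
      ⟨_, _, _, OpenPolygon.isEvenConfiguration n hn he, fun i => ?_⟩⟩
    have hm := OpenPolygon.range_mids (p := OpenPolygon.evenParams n hn he)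
    exact ⟨by rw [hm]; exact OpenPolygon.cyc_mem_acl (p := OpenPolygon.evenParams n hn he) i,
      by rw [hm]; exact OpenPolygon.cyc_notMem_dcl (p := OpenPolygon.evenParams n hn he) i⟩
  · refine ⟨OpenPolygon.Poly (OpenPolygon.oddParams n hn ho), OpenPolygon.polyGraph _,
      OpenPolygon.polyPoints _, OpenPolygon.isOpenPolygon (p := OpenPolygon.oddParams n hn ho),
      OpenPolygon.models_theory (p := OpenPolygon.oddParams n hn ho),
      OpenPolygon.acl_ne_dcl (p := OpenPolygon.oddParams n hn ho), fun _ =>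
      ⟨_, _, OpenPolygon.isOddConfiguration n hn ho, fun i => ?_⟩,
      fun he => absurd he (Nat.not_even_iff_odd.2 ho)⟩
    have hm := OpenPolygon.range_mids (p := OpenPolygon.oddParams n hn ho)
    exact ⟨by rw [hm]; exact OpenPolygon.cyc_mem_acl (p := OpenPolygon.oddParams n hn ho) i,
      by rw [hm]; exact OpenPolygon.cyc_notMem_dcl (p := OpenPolygon.oddParams n hn ho) i⟩
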